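/- Let $n$ and $p$ be natural numbers with $0\le p\le n$, let $r_1,\dots,r_n>0$, and equip $\mathbb C^n$ with the Hermitian form $$\langle\langle z,w\rangle\rangle_p=-\sum_{j=1}^{p}z_j\bar w_j+\sum_{j=p+1}^{n}z_j\bar w_j ,$$ the flat pseudo-Riemannian metric $g=\mathrm{Re}\,\langle\langle\cdot,\cdot\rangle\rangle_p$, the complex structure $J=i$ and the symplectic form $\omega=g(J\cdot,\cdot)$. A smooth compactly supported vector field $X$ on $\mathbb C^n$ is Hamiltonian if the one-form $\omega(X,\cdot)$ is exact; $\exp_t(X)$ denotes its flow. The volume $\mathcal V$ of a compact $n$-dimensional submanifold is the integral of the density $|\det(g_{ij})|^{1/2}$ of its induced metric. An $n$-dimensional submanifold is Lagrangian if $\omega$ vanishes on it. A compact Lagrangian submanifold $L$ with non-degenerate induced metric is H-minimal if $\frac{d}{dt}\mathcal V(\exp_t(X)(L))|_{t=0}=0$ for every such $X$; it is H-unstable if its Hamiltonian second variation $\delta^2\mathcal V(L)(X)=\frac{d^2}{dt^2}\mathcal V(\exp_t(X)(L))|_{t=0}$, for Hamiltonian $X$ normal to $L$ along $L$, is indefinite,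 that is, takes both positive and negative values. Then the product of circles $\mathbb T=S^1(r_1)\times\dots\times S^1(r_n)\subset\mathbb C^n$, where $S^1(r)=\{z\in\mathbb C:|z|=r\}$, which is parametrized by $\theta\mapsto(r_1e^{i\theta_1},\dots,r_ne^{i\theta_n})$, is an embedded Lagrangian torus with non-degenerate induced metric, and it is H-minimal. Moreover, if $p\neq 0$ and $p\neq n$, then $\mathbb T$ is H-unstable. -/

import Mathlib

open scoped ContDiff Topology

noncomputable section

namespace PseudoKahler

/-- The sign of the `j`-th coordinate: `-1` for the first `p` coordinates, `+1` for the others. -/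
def sgn (p : ℕ) {n : ℕ} (j : Fin n) : ℝ := if (j : ℕ) < p then -1 else 1

/-- The Hermitian form `-∑_{j ≤ p} dz_j ⊗ dz̄_j + ∑_{j > p} dz_j ⊗ dz̄_j` on `ℂⁿ`. -/
def herm (p : ℕ) {n : ℕ} (z w : Fin n → ℂ) : ℂ :=
  ∑ j, (sgn p j : ℂ) * (z j * (starRingEnd ℂ) (w j))

/-- The flat pseudo-Riemannian metric on `ℂⁿ`: the real part of the Hermitian form. -/
def metric (p : ℕ) {n : ℕ} (z w : Fin n → ℂ) : ℝ := (herm p z w).re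

/-- The symplectic form `ω = g(J·, ·)` on `ℂⁿ`, where `J` is the multiplication by `i`. -/
def omega (p : ℕ) {n : ℕ} (z w : Fin n → ℂ) : ℝ := metric p (Complex.I • z) w

/-- `f : ℝⁿ → ℂⁿ` induces an embedding of the torus `(ℝ / 2πℤ)ⁿ`: it is smooth, an immersion, and
takes the same value at two points exactly when they agree modulo `2π` in every coordinate. Its
range is then a compact embedded `n`-dimensional submanifold of `ℂⁿ`. -/
structure IsEmbeddedTorus {n : ℕ} (f : (Fin n → ℝ) → (Fin n → ℂ)) : Prop where
  smooth : ContDiff ℝ ∞ f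
  immersion : ∀ θ, Function.Injective (fderiv ℝ f θ)
  eq_iff : ∀ θ θ', f θ = f θ' ↔ ∀ j, ∃ k : ℤ, θ' j = θ j + k * (2 * Real.pi)

/-- The embedded (`n`-dimensional) torus `f` is a Lagrangian submanifold: `ω` vanishes on it. -/
def IsLagrangian (p : ℕ) {n : ℕ} (f : (Fin n → ℝ) → (Fin n → ℂ)) : Prop :=
  IsEmbeddedTorus f ∧ ∀ θ v w, omega p (fderiv ℝ f θ v) (fderiv ℝ f θ w) = 0

/-- The matrix of the metric induced by `f`, in the coordinates `θ`. -/
def inducedMetric (p : ℕ) {n : ℕ} (f : (Fin n → ℝ) → (Fin n → ℂ)) (θ : Fin n → ℝ) :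
    Matrix (Fin n) (Fin n) ℝ :=
  Matrix.of fun i j =>
    metric p (fderiv ℝ f θ (Pi.single i 1)) (fderiv ℝ f θ (Pi.single j 1))

/-- The volume of the torus `f`: the integral of the volume density `|det g_{ij}|^{1/2}` of the
induced metric over a fundamental domain. -/
def vol (p : ℕ) {n : ℕ} (f : (Fin n → ℝ) → (Fin n → ℂ)) : ℝ :=
  ∫ θ in Set.Icc (0 : Fin n → ℝ) (fun _ => 2 * Real.pi), √|(inducedMetric p f θ).det|

/-- `X` is a compactly supported Hamiltonian vector field on `ℂⁿ`: the one-form `ω(X, ·)` is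
exact. -/
structure IsHamiltonian (p : ℕ) {n : ℕ} (X : (Fin n → ℂ) → (Fin n → ℂ)) : Prop where
  smooth : ContDiff ℝ ∞ X
  compactSupport : HasCompactSupport X
  exact_form : ∃ H : (Fin n → ℂ) → ℝ, ContDiff ℝ ∞ H ∧
    ∀ z v, omega p (X z) v = fderiv ℝ H z v

/-- `Φ t = exp_t(X)` is the (smooth) flow of the vector field `X`, for small times and near the
set `L`. -/
def IsFlowNear {n : ℕ} (X : (Fin n → ℂ) → (Fin n → ℂ)) (L : Set (Fin n → ℂ))
    (Φ : ℝ → (Fin n → ℂ) → (Fin n → ℂ)) : Prop :=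
  ∃ δ > (0 : ℝ), ∃ U : Set (Fin n → ℂ), IsOpen U ∧ L ⊆ U ∧
    ContDiffOn ℝ ∞ (fun q : ℝ × (Fin n → ℂ) => Φ q.1 q.2) (Set.Ioo (-δ) δ ×ˢ U) ∧
    (∀ z ∈ U, Φ 0 z = z) ∧
    ∀ t ∈ Set.Ioo (-δ) δ, ∀ z ∈ U, HasDerivAt (fun s => Φ s z) (X (Φ t z)) t

/-- The torus `f` is H-minimal: its induced metric is non-degenerate, and it is a critical point of
the volume under all Hamiltonian variations. -/
def IsHMinimal (p : ℕ) {n : ℕ} (f : (Fin n → ℝ) → (Fin n → ℂ)) : Prop :=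
  (∀ θ, (inducedMetric p f θ).det ≠ 0) ∧
  ∀ X, IsHamiltonian p X → ∀ Φ, IsFlowNear X (Set.range f) Φ →
    HasDerivAt (fun t => vol p (fun θ => Φ t (f θ))) 0 0

/-- `c` is the second variation `δ²V(L)(X) = d²/dt² V(exp_t(X)(L))` at `t = 0`, for a Hamiltonian
vector field `X` which is normal to the torus `L` given by `f`. -/
def HasSecondVariation (p : ℕ) {n : ℕ} (f : (Fin n → ℝ) → (Fin n → ℂ))
    (X : (Fin n → ℂ) → (Fin n → ℂ)) (c : ℝ) : Prop :=
  IsHamiltonian p X ∧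
  (∀ θ v, metric p (X (f θ)) (fderiv ℝ f θ v) = 0) ∧
  ∃ Φ, IsFlowNear X (Set.range f) Φ ∧
    ∃ V' : ℝ → ℝ, (∀ᶠ t in 𝓝 0, HasDerivAt (fun s => vol p (fun θ => Φ s (f θ))) (V' t) t) ∧
      HasDerivAt V' c 0

/-- The torus `f` is H-unstable: the Hamiltonian second variation of its volume is indefinite. -/
def IsHUnstable (p : ℕ) {n : ℕ} (f : (Fin n → ℝ) → (Fin n → ℂ)) : Prop :=
  (∃ X c, HasSecondVariation p f X c ∧ 0 < c) ∧ ∃ X c, HasSecondVariation p f X c ∧ c < 0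

/-- The parametrization `θ ↦ (r_j exp(i θ_j))_j` of `S¹(r₁) × … × S¹(rₙ)`. -/
def circleProduct {n : ℕ} (r : Fin n → ℝ) (θ : Fin n → ℝ) : Fin n → ℂ :=
  fun j => (r j : ℂ) * Complex.exp (θ j * Complex.I)

end PseudoKahler

end

noncomputable section

namespace PseudoKahler

open MeasureTheory ComplexConjugate

/-! Write `ε_j` for `sgn p j`. On the torus the induced metric is the constant diagonal matrix with
entries `ε_j r_j²`.

H-minimality is an integration by parts. At a diagonal metric only the diagonal entries contribute
to the first variation of the density, which is a constant combination of the terms `Re (∂_j X_j ·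
conj (i e^{iθ_j}))` (`dt_density_flow`). By the product rule each is the `θ_j`-derivative of `Re
(X_j · conj (i e^{iθ_j}))` plus `Re (X_j · conj (e^{iθ_j}))`, and the Hamiltonian condition makes
the latter a multiple of a derivative of `H` along the torus (`fderiv_variationPotential`). So every
summand is a partial derivative of a periodic function and integrates to zero
(`integral_box_fderiv_single_eq_zero`).

For instability the test Hamiltonian is `cos (∑ m_j θ_j)`, the real part of `∏ (z_j / |z_j|)^{m_j}`,
cut off away from the torus. It depends on the arguments only, so its field is radial
(`hamField_of_eqOn`), hence normal to the torus, and its flow is explicit: arguments are fixed and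
each `|z_j|²` changes linearly in time. The metric of the moved torus is a diagonal matrix plus one
of rank at most one, so its determinant is explicit (`density_phaseFlow`). Differentiating twice
(`second_deriv_sqrt_prod`) and averaging `sin²` and `cos²` gives, up to a positive factor, `(∑ ε_j
m_j / r_j²)² - 2 ∑ m_j² / r_j⁴ + (∑ ε_j m_j² / r_j²)²`. This is `12 / r_a⁴` for `m = 2 e_a`, and `-4
/ (r_a² r_b²)` for `m = e_a + e_b` with `ε_a = -1`, `ε_b = 1`. -/

/-- The derivative in the first variable of a function on `ℝ × E`. -/
def dt {E : Type*} [NormedAddCommGroup E] [NormedSpace ℝ E] (I : ℝ × E → ℝ) (q : ℝ × E) : ℝ :=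
  fderiv ℝ I q (1, 0)

/-! ### Differentiation under the integral sign. -/

section Parametric

variable {E : Type*} [NormedAddCommGroup E] [NormedSpace ℝ E]

theorem hasDerivAt_fst {F : Type*} [NormedAddCommGroup F] [NormedSpace ℝ F] {f : ℝ × E → F}
    {t : ℝ} {x : E} (h : DifferentiableAt ℝ f (t, x)) :
    HasDerivAt (fun s => f (s, x)) (fderiv ℝ f (t, x) (1, 0)) t :=
  HasFDerivAt.comp_hasDerivAt (l := f) (f := fun s : ℝ => (s, x)) t h.hasFDerivAt
    ((hasDerivAt_id t).prodMk (hasDerivAt_const t x))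

theorem hasFDerivAt_snd {F : Type*} [NormedAddCommGroup F] [NormedSpace ℝ F] {f : ℝ × E → F}
    {t : ℝ} {x : E} (h : DifferentiableAt ℝ f (t, x)) :
    HasFDerivAt (fun y => f (t, y)) ((fderiv ℝ f (t, x)).comp (ContinuousLinearMap.inr ℝ ℝ E)) x :=
  HasFDerivAt.comp (g := f) (f := fun y : E => (t, y)) x h.hasFDerivAt
    (hasFDerivAt_prodMk_right t x)

theorem contDiffOn_dt {I : ℝ × E → ℝ} {N : Set (ℝ × E)} (hN : IsOpen N)
    (hI : ContDiffOn ℝ ∞ I N) : ContDiffOn ℝ ∞ (dt I) N :=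
  (hI.fderiv_of_isOpen hN (by simp)).clm_apply contDiffOn_const

theorem hasDerivAt_dt {I : ℝ × E → ℝ} {N : Set (ℝ × E)} (hN : IsOpen N)
    (hI : ContDiffOn ℝ ∞ I N) {t : ℝ} {x : E} (h : (t, x) ∈ N) :
    HasDerivAt (fun s => I (s, x)) (dt I (t, x)) t :=
  hasDerivAt_fst ((hI.contDiffAt (hN.mem_nhds h)).differentiableAt (by simp))

/-- Differentiation under the integral sign over a compact set. -/
theorem eventually_hasDerivAt_setIntegral [MeasurableSpace E] [BorelSpace E]
    [SecondCountableTopology E] {μ : Measure E} [IsFiniteMeasureOnCompacts μ]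
    {K : Set E} (hK : IsCompact K) {I : ℝ × E → ℝ} {N : Set (ℝ × E)} (hN : IsOpen N)
    (hI : ContDiffOn ℝ ∞ I N) (hKN : ∀ x ∈ K, ((0 : ℝ), x) ∈ N) :
    ∀ᶠ t in 𝓝 (0 : ℝ),
      HasDerivAt (fun s => ∫ x in K, I (s, x) ∂μ) (∫ x in K, dt I (t, x) ∂μ) t := by
  -- The tube lemma gives one time interval valid for all of `K`; halving it gives a compact product
  -- on which the `t`-derivative is bounded by a constant.
  obtain ⟨u, v, hu, -, h0, hKv, huv⟩ := generalized_tube_lemma (isCompact_singleton (x := (0 : ℝ)))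
    hK hN (by rintro ⟨t, x⟩ ⟨rfl, hx⟩; exact hKN x hx)
  obtain ⟨ε, hε, hball⟩ := Metric.isOpen_iff.1 hu 0 (h0 rfl)
  have hsub : Metric.closedBall (0 : ℝ) (ε / 2) ×ˢ K ⊆ N := fun q hq =>
    huv ⟨hball (Metric.closedBall_subset_ball (by linarith) hq.1), hKv hq.2⟩
  have hcomp : IsCompact (Metric.closedBall (0 : ℝ) (ε / 2) ×ˢ K) :=
    (isCompact_closedBall _ _).prod hK
  have hdI := (contDiffOn_dt hN hI).continuousOn
  obtain ⟨C, hC⟩ := hcomp.exists_bound_of_continuousOn (hdI.mono hsub)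
  have hslice : ∀ J : ℝ × E → ℝ, ContinuousOn J N → ∀ s ∈ Metric.closedBall (0 : ℝ) (ε / 2),
      ContinuousOn (fun x => J (s, x)) K := fun J hJ s hs =>
    hJ.comp (by fun_prop) fun x hx => hsub ⟨hs, hx⟩
  filter_upwards [Metric.ball_mem_nhds (0 : ℝ) (half_pos hε)] with t ht
  have hnhds : Metric.ball (0 : ℝ) (ε / 2) ∈ 𝓝 t := Metric.isOpen_ball.mem_nhds ht
  refine (hasDerivAt_integral_of_dominated_loc_of_deriv_le (μ := μ.restrict K)
    (F := fun s x => I (s, x)) (F' := fun s x => dt I (s, x)) (bound := fun _ => C) hnhds ?_ ?_ ?_ ?_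
    ?_ ?_).2
  · filter_upwards [hnhds] with s hs
    exact ((hslice I hI.continuousOn s (Metric.ball_subset_closedBall hs)).integrableOn_compact
      hK).aestronglyMeasurable
  · exact (hslice I hI.continuousOn t (Metric.ball_subset_closedBall ht)).integrableOn_compact hK
  · exact ((hslice _ hdI t (Metric.ball_subset_closedBall ht)).integrableOn_compact
      hK).aestronglyMeasurable
  · exact (ae_restrict_mem hK.measurableSet).mono fun x hx s hs =>
      hC (s, x) ⟨Metric.ball_subset_closedBall hs, hx⟩
  · exact integrableOn_const hK.measure_lt_top.ne
  · exact (ae_restrict_mem hK.measurableSet).mono fun x hx s hs =>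
      hasDerivAt_dt hN hI (hsub ⟨Metric.ball_subset_closedBall hs, hx⟩)

end Parametric

/-! ### Calculus on the period box and derivatives of determinants. -/

/-- The fundamental domain `[0, 2π]ⁿ` of the torus. -/
abbrev box (n : ℕ) : Set (Fin n → ℝ) := Set.Icc (0 : Fin n → ℝ) (fun _ => 2 * Real.pi)

/-- The integral over a period box of a partial derivative of a periodic function vanishes. -/
theorem integral_box_fderiv_single_eq_zero {n : ℕ} {u : (Fin n → ℝ) → ℝ} (hu : ContDiff ℝ 1 u)
    (j : Fin n) (hper : ∀ θ, u (θ + Pi.single j (2 * Real.pi)) = u θ) :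
    ∫ θ in box n, fderiv ℝ u θ (Pi.single j 1) = 0 := by
  obtain _ | n := n
  · exact j.elim0
  have hcont : Continuous fun θ => fderiv ℝ u θ (Pi.single j 1) :=
    (hu.continuous_fderiv (by simp)).clm_apply continuous_const
  have hsum : ∀ θ, ∑ i, (if i = j then fderiv ℝ u θ else 0) (Pi.single i 1)
      = fderiv ℝ u θ (Pi.single j 1) := fun θ => by
    rw [Finset.sum_eq_single j] <;> simp +contextual
  -- Divergence theorem for the field whose only component is `u` in direction `j`; periodicity then
  -- cancels the two opposite faces.
  have key := integral_divergence_of_hasFDerivAt_off_countable' (0 : Fin (n + 1) → ℝ)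
    (fun _ => 2 * Real.pi) (fun _ => by positivity) (fun i => if i = j then u else 0)
    (fun i θ => if i = j then fderiv ℝ u θ else 0) ∅ Set.countable_empty
    (fun i => by
      split_ifs
      · exact hu.continuous.continuousOn
      · exact continuousOn_const)
    (fun θ _ i => by
      split_ifs
      · exact (hu.differentiable (by simp) θ).hasFDerivAt
      · exact hasFDerivAt_const 0 θ)
    (by
      simp only [hsum]
      exact hcont.continuousOn.integrableOn_compact isCompact_Icc)
  simp only [hsum] at key
  rw [key, Finset.sum_eq_single j]
  · simp only [if_true, sub_eq_zero]
    refine integral_congr_ae (Filter.Eventually.of_forall fun x => ?_)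
    simp only
    rw [← hper (j.insertNth (α := fun _ => ℝ) ((0 : Fin (n + 1) → ℝ) j) x)]
    have : j.insertNth (α := fun _ => ℝ) ((0 : Fin (n + 1) → ℝ) j) x + Pi.single j (2 * Real.pi)
        = j.insertNth (α := fun _ => ℝ) (2 * Real.pi) x := by
      ext i
      refine Fin.succAboveCases j ?_ (fun k => ?_) i <;> simp [Fin.succAbove_ne]
    rw [this]
  · intro i _ hij
    simp [hij]
  · simp

/-- The derivative of the determinant at a diagonal matrix. -/
theorem hasDerivAt_det_of_diagonal {ι : Type*} [Fintype ι] [DecidableEq ι]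
    {M : ℝ → Matrix ι ι ℝ} {M' : Matrix ι ι ℝ} {t : ℝ} {d : ι → ℝ}
    (h : ∀ i j, HasDerivAt (fun s => M s i j) (M' i j) t) (hd : M t = Matrix.diagonal d) :
    HasDerivAt (fun s => (M s).det) (∑ i, (∏ j ∈ Finset.univ.erase i, d j) * M' i i) t := by
  simp only [Matrix.det_apply']
  have key : HasDerivAt (fun s => ∑ σ : Equiv.Perm ι, ((Equiv.Perm.sign σ : ℤ) : ℝ)
        * ∏ i, M s (σ i) i)
      (∑ σ : Equiv.Perm ι, ((Equiv.Perm.sign σ : ℤ) : ℝ) *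
        ∑ i, (∏ j ∈ Finset.univ.erase i, M t (σ j) j) • M' (σ i) i) t :=
    HasDerivAt.fun_sum fun σ _ => (HasDerivAt.fun_finsetProd fun i _ => h (σ i) i).const_mul _
  convert key using 1
  rw [Finset.sum_eq_single (1 : Equiv.Perm ι)]
  · simp [hd]
  · intro σ _ hσ
    refine mul_eq_zero_of_right _ (Finset.sum_eq_zero fun i _ => ?_)
    -- A non-identity permutation moves at least two points, so an off-diagonal zero survives after
    -- the factor at `i` is removed.
    have : ∃ j, j ≠ i ∧ σ j ≠ j := by
      by_contra! hcon
      refine hσ (Equiv.ext fun j => ?_)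
      by_cases hj : j = i
      · subst hj
        by_contra hne
        exact hne (σ.injective (hcon _ hne))
      · exact hcon j hj
    obtain ⟨j, hji, hj⟩ := this
    rw [Finset.prod_eq_zero (i := j) (by simp [hji]) (by simp [hd, hj]), zero_smul]
  · simp

/-- The derivative of `√|D|` where `D ≠ 0`. -/
theorem hasDerivAt_sqrt_abs {D : ℝ → ℝ} {D' t : ℝ} (h : HasDerivAt D D' t) (h0 : D t ≠ 0) :
    HasDerivAt (fun s => √|D s|) (√|D t| * (D' / (2 * D t))) t := by
  have hs : √|D t| ≠ 0 := by positivity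
  have hsq : √|D t| ^ 2 = |D t| := Real.sq_sqrt (abs_nonneg _)
  have key : HasDerivAt (fun s => |D s|) (SignType.sign (D t) * D') t :=
    (hasDerivAt_abs h0).comp t h
  convert key.sqrt (abs_ne_zero.2 h0) using 1
  have hsign : (SignType.sign (D t) : ℝ) * |D t| = D t := sign_mul_abs _
  have hsign' : (SignType.sign (D t) : ℝ) * D t = |D t| := sign_mul_self _
  field_simp
  rw [hsq, ← hsign']
  ring

/-! ### The metric, and the product of circles as a Lagrangian torus. -/

theorem sgn_mul_self (p : ℕ) {n : ℕ} (j : Fin n) : sgn p j * sgn p j = 1 := by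
  unfold sgn; split_ifs <;> norm_num

theorem sgn_ne_zero (p : ℕ) {n : ℕ} (j : Fin n) : sgn p j ≠ 0 := by
  unfold sgn; split_ifs <;> norm_num

theorem abs_sgn (p : ℕ) {n : ℕ} (j : Fin n) : |sgn p j| = 1 := by
  unfold sgn; split_ifs <;> norm_num

theorem metric_eq_sum (p : ℕ) {n : ℕ} (z w : Fin n → ℂ) :
    metric p z w = ∑ j, sgn p j * (z j * conj (w j)).re := by
  simp only [metric, herm, Complex.re_sum, Complex.re_ofReal_mul]

theorem omega_eq_sum (p : ℕ) {n : ℕ} (z w : Fin n → ℂ) :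
    omega p z w = ∑ j, sgn p j * (Complex.I * z j * conj (w j)).re := by
  simp only [omega, metric_eq_sum, Pi.smul_apply, smul_eq_mul]

/-- The differential of `circleProduct r` at `θ`. -/
def circleProductDeriv {n : ℕ} (r θ : Fin n → ℝ) : (Fin n → ℝ) →L[ℝ] (Fin n → ℂ) :=
  ContinuousLinearMap.pi fun j =>
    (ContinuousLinearMap.proj j : (Fin n → ℝ) →L[ℝ] ℝ).smulRight
      ((r j : ℂ) * (Complex.exp (θ j * Complex.I) * Complex.I))

section CircleProduct

variable {n : ℕ} (r : Fin n → ℝ)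

theorem circleProductDeriv_apply (θ v : Fin n → ℝ) (j : Fin n) :
    circleProductDeriv r θ v j
      = v j * ((r j : ℂ) * (Complex.exp (θ j * Complex.I) * Complex.I)) := by
  simp [circleProductDeriv]

theorem contDiff_exp_coord (j : Fin n) :
    ContDiff ℝ ∞ fun θ : Fin n → ℝ => Complex.exp (θ j * Complex.I) := by
  have : ContDiff ℝ ∞ fun θ : Fin n → ℝ => ((θ j : ℝ) : ℂ) :=
    Complex.ofRealCLM.contDiff.comp (contDiff_apply ℝ ℝ j)
  exact (this.mul contDiff_const).cexp

theorem hasDerivAt_exp_mul_I (x : ℝ) :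
    HasDerivAt (fun x : ℝ => Complex.exp (x * Complex.I)) (Complex.exp (x * Complex.I) * Complex.I)
      x := by
  simpa using ((hasDerivAt_id x).ofReal_comp.mul_const Complex.I).cexp

theorem hasFDerivAt_exp_coord (θ : Fin n → ℝ) (j : Fin n) :
    HasFDerivAt (fun θ : Fin n → ℝ => Complex.exp (θ j * Complex.I))
      ((ContinuousLinearMap.proj j : (Fin n → ℝ) →L[ℝ] ℝ).smulRight
        (Complex.exp (θ j * Complex.I) * Complex.I)) θ := by
  have := (hasDerivAt_exp_mul_I (θ j)).hasFDerivAt.comp θ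
    (ContinuousLinearMap.proj (R := ℝ) (φ := fun _ : Fin n => ℝ) j).hasFDerivAt
  exact this.congr_fderiv (by ext v; simp)

theorem hasFDerivAt_circleProduct (θ : Fin n → ℝ) :
    HasFDerivAt (circleProduct r) (circleProductDeriv r θ) θ := by
  refine hasFDerivAt_pi.2 fun j => ?_
  refine ((hasFDerivAt_exp_coord θ j).const_mul (r j : ℂ)).congr_fderiv ?_
  ext v
  simp only [ContinuousLinearMap.smulRight_apply, smul_apply, ContinuousLinearMap.proj_apply,
    Complex.real_smul, smul_eq_mul]
  ring

theorem fderiv_circleProduct_apply (θ v : Fin n → ℝ) (j : Fin n) :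
    fderiv ℝ (circleProduct r) θ v j
      = v j * ((r j : ℂ) * (Complex.exp (θ j * Complex.I) * Complex.I)) := by
  rw [(hasFDerivAt_circleProduct r θ).fderiv, circleProductDeriv_apply]

theorem contDiff_circleProduct : ContDiff ℝ ∞ (circleProduct r) :=
  contDiff_pi.2 fun j => contDiff_const.mul (contDiff_exp_coord j)

theorem exp_mul_conj_exp (x : ℝ) :
    Complex.exp (x * Complex.I) * conj (Complex.exp (x * Complex.I)) = 1 := by
  rw [Complex.mul_conj, Complex.normSq_eq_norm_sq, Complex.norm_exp_ofReal_mul_I]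
  simp

theorem norm_circleProduct (hr : ∀ j, 0 < r j) (θ : Fin n → ℝ) (j : Fin n) :
    ‖circleProduct r θ j‖ = r j := by
  simp [circleProduct, Complex.norm_exp_ofReal_mul_I, abs_of_pos (hr j)]

theorem range_circleProduct (hr : ∀ j, 0 < r j) :
    Set.range (circleProduct r) = Set.univ.pi fun j => Metric.sphere (0 : ℂ) (r j) := by
  ext z
  simp only [Set.mem_range, Set.mem_univ_pi, mem_sphere_zero_iff_norm]
  constructor
  · rintro ⟨θ, rfl⟩ j
    exact norm_circleProduct r hr θ j
  · intro h
    refine ⟨fun j => (z j).arg, funext fun j => ?_⟩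
    rw [circleProduct, ← h j, Complex.norm_mul_exp_arg_mul_I]

theorem isCompact_range_circleProduct (hr : ∀ j, 0 < r j) :
    IsCompact (Set.range (circleProduct r)) := by
  rw [range_circleProduct r hr]
  exact isCompact_univ_pi fun j => isCompact_sphere _ _

theorem isEmbeddedTorus_circleProduct (hr : ∀ j, 0 < r j) : IsEmbeddedTorus (circleProduct r) where
  smooth := contDiff_circleProduct r
  immersion θ v w h := by
    ext j
    have := congrFun h j
    simp only [fderiv_circleProduct_apply] at this
    have h0 : (r j : ℂ) * (Complex.exp (θ j * Complex.I) * Complex.I) ≠ 0 := by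
      simp [(hr j).ne']
    exact_mod_cast mul_right_cancel₀ h0 this
  eq_iff θ θ' := by
    rw [funext_iff]
    refine forall_congr' fun j => ?_
    rw [circleProduct, circleProduct, eq_comm,
      mul_right_inj' (by exact_mod_cast (hr j).ne' : (r j : ℂ) ≠ 0), Complex.exp_eq_exp_iff_exists_int]
    refine exists_congr fun k => ?_
    have : ((θ j : ℂ) * Complex.I + k * (2 * Real.pi * Complex.I))
        = ((θ j + k * (2 * Real.pi) : ℝ) : ℂ) * Complex.I := by
      push_cast; ring
    rw [this, mul_left_inj' Complex.I_ne_zero]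
    norm_cast

/-- In each coordinate both tangent vectors are real multiples of `i e^{iθ_j}`, so the extra factor
`i` makes every summand purely imaginary. -/
theorem isLagrangian_circleProduct (p : ℕ) (hr : ∀ j, 0 < r j) :
    IsLagrangian p (circleProduct r) := by
  refine ⟨isEmbeddedTorus_circleProduct r hr, fun θ v w => ?_⟩
  rw [omega_eq_sum]
  refine Finset.sum_eq_zero fun j _ => ?_
  simp only [fderiv_circleProduct_apply]
  have : Complex.I * (v j * ((r j : ℂ) * (Complex.exp (θ j * Complex.I) * Complex.I)))
      * conj (w j * ((r j : ℂ) * (Complex.exp (θ j * Complex.I) * Complex.I)))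
      = ((v j * w j * r j ^ 2 : ℝ) : ℂ) * Complex.I := by
    simp only [map_mul, Complex.conj_ofReal, Complex.conj_I]
    push_cast
    linear_combination (v j * w j * r j ^ 2 * Complex.I : ℂ) * exp_mul_conj_exp (θ j)
      - (v j * w j * r j ^ 2 * Complex.I * (Complex.exp (θ j * Complex.I)
        * conj (Complex.exp (θ j * Complex.I))) : ℂ) * Complex.I_mul_I
  rw [this, Complex.re_ofReal_mul, Complex.I_re, mul_zero, mul_zero]

theorem inducedMetric_circleProduct (p : ℕ) (θ : Fin n → ℝ) :
    inducedMetric p (circleProduct r) θ = Matrix.diagonal fun j => sgn p j * r j ^ 2 := by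
  ext i j
  rw [inducedMetric, Matrix.of_apply, metric_eq_sum]
  simp only [fderiv_circleProduct_apply]
  rw [Finset.sum_eq_single j]
  · obtain rfl | hij := eq_or_ne i j
    · simp only [Pi.single_eq_same, Matrix.diagonal_apply_eq]
      congr 1
      have : ((1 : ℝ) : ℂ) * ((r i : ℂ) * (Complex.exp (θ i * Complex.I) * Complex.I))
          * conj (((1 : ℝ) : ℂ) * ((r i : ℂ) * (Complex.exp (θ i * Complex.I) * Complex.I)))
          = ((r i ^ 2 : ℝ) : ℂ) := by
        simp only [map_mul, Complex.conj_ofReal, Complex.conj_I]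
        push_cast
        linear_combination (r i ^ 2 : ℂ) * exp_mul_conj_exp (θ i)
          - (r i ^ 2 * (Complex.exp (θ i * Complex.I)
            * conj (Complex.exp (θ i * Complex.I))) : ℂ) * Complex.I_mul_I
      rw [this, Complex.ofReal_re]
    · simp [hij]
  · intro k _ hk
    simp [Pi.single_eq_of_ne hk]
  · simp

theorem det_inducedMetric_circleProduct_ne_zero (p : ℕ) (hr : ∀ j, 0 < r j) (θ : Fin n → ℝ) :
    (inducedMetric p (circleProduct r) θ).det ≠ 0 := by
  rw [inducedMetric_circleProduct, Matrix.det_diagonal]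
  exact Finset.prod_ne_zero_iff.2 fun j _ => mul_ne_zero (sgn_ne_zero p j) (pow_pos (hr j) 2).ne'

end CircleProduct

/-! ### The volume of a smooth family of tori -/

section Family

variable {n : ℕ} {F : ℝ → (Fin n → ℝ) → (Fin n → ℂ)} {δ : ℝ}

/-- Spatial derivatives of each slice become derivatives of the joint map, which makes the metric
visibly smooth in time and space together. -/
theorem inducedMetric_family (p : ℕ) {q : ℝ × (Fin n → ℝ)}
    (h : DifferentiableAt ℝ (fun q : ℝ × (Fin n → ℝ) => F q.1 q.2) q) (i j : Fin n) :
    inducedMetric p (F q.1) q.2 i j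
      = metric p (fderiv ℝ (fun q : ℝ × (Fin n → ℝ) => F q.1 q.2) q (0, Pi.single i 1))
          (fderiv ℝ (fun q : ℝ × (Fin n → ℝ) => F q.1 q.2) q (0, Pi.single j 1)) := by
  have := (hasFDerivAt_snd (t := q.1) (x := q.2) h).fderiv
  simp only at this
  simp [inducedMetric, this]

theorem contDiffOn_metric (p : ℕ) {E : Type*} [NormedAddCommGroup E] [NormedSpace ℝ E]
    {f g : E → Fin n → ℂ} {s : Set E} (hf : ContDiffOn ℝ ∞ f s) (hg : ContDiffOn ℝ ∞ g s) :
    ContDiffOn ℝ ∞ (fun x => metric p (f x) (g x)) s := by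
  simp only [metric_eq_sum]
  refine ContDiffOn.sum fun j _ => contDiffOn_const.mul ?_
  refine Complex.reCLM.contDiff.comp_contDiffOn (ContDiffOn.mul (contDiffOn_pi.1 hf j) ?_)
  exact Complex.conjCLE.contDiff.comp_contDiffOn (contDiffOn_pi.1 hg j)

/-- The set where the induced metric of a family of tori is non-degenerate. -/
def nondegSet (p : ℕ) (F : ℝ → (Fin n → ℝ) → (Fin n → ℂ)) (δ : ℝ) : Set (ℝ × (Fin n → ℝ)) :=
  (Set.Ioo (-δ) δ ×ˢ Set.univ) ∩ {q | (inducedMetric p (F q.1) q.2).det ≠ 0}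

/-- The volume density of a family of tori. -/
def density (p : ℕ) (F : ℝ → (Fin n → ℝ) → (Fin n → ℂ)) (q : ℝ × (Fin n → ℝ)) : ℝ :=
  √|(inducedMetric p (F q.1) q.2).det|

variable (p : ℕ)
  (hF : ContDiffOn ℝ ∞ (fun q : ℝ × (Fin n → ℝ) => F q.1 q.2) (Set.Ioo (-δ) δ ×ˢ Set.univ))

include hF

theorem contDiffOn_det_inducedMetric :
    ContDiffOn ℝ ∞ (fun q : ℝ × (Fin n → ℝ) => (inducedMetric p (F q.1) q.2).det)
      (Set.Ioo (-δ) δ ×ˢ Set.univ) := by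
  have ho : IsOpen (Set.Ioo (-δ) δ ×ˢ (Set.univ : Set (Fin n → ℝ))) := isOpen_Ioo.prod isOpen_univ
  simp only [Matrix.det_apply']
  refine ContDiffOn.sum fun σ _ => contDiffOn_const.mul (contDiffOn_prod fun i _ => ?_)
  have hd := hF.fderiv_of_isOpen ho (m := ∞) (by simp)
  exact (contDiffOn_metric p (hd.clm_apply contDiffOn_const)
    (hd.clm_apply contDiffOn_const)).congr fun q hq =>
      inducedMetric_family p ((hF.contDiffAt (ho.mem_nhds hq)).differentiableAt (by simp)) _ _

theorem isOpen_nondegSet : IsOpen (nondegSet p F δ) :=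
  (contDiffOn_det_inducedMetric p hF).continuousOn.isOpen_inter_preimage
    (isOpen_Ioo.prod isOpen_univ) isOpen_compl_singleton

theorem contDiffOn_density : ContDiffOn ℝ ∞ (density p F) (nondegSet p F δ) := fun q hq =>
  ((((contDiffOn_det_inducedMetric p hF).mono Set.inter_subset_left q hq).abs hq.2).sqrt
    (abs_ne_zero.2 hq.2))

/-- Non-degeneracy is assumed only at time zero: it is an open condition, and the period box is
compact, so it persists for small times. -/
theorem eventually_hasDerivAt_vol (hδ : 0 < δ)
    (h0 : ∀ θ, (inducedMetric p (F 0) θ).det ≠ 0) :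
    ∀ᶠ t in 𝓝 (0 : ℝ),
      HasDerivAt (fun s => vol p (F s)) (∫ θ in box n, dt (density p F) (t, θ)) t :=
  eventually_hasDerivAt_setIntegral isCompact_Icc (isOpen_nondegSet p hF) (contDiffOn_density p hF)
    fun θ _ => ⟨⟨by simpa using hδ, trivial⟩, h0 θ⟩

theorem hasDerivAt_integral_dt_density (hδ : 0 < δ)
    (h0 : ∀ θ, (inducedMetric p (F 0) θ).det ≠ 0) :
    HasDerivAt (fun s => ∫ θ in box n, dt (density p F) (s, θ))
      (∫ θ in box n, dt (dt (density p F)) (0, θ)) 0 :=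
  (eventually_hasDerivAt_setIntegral isCompact_Icc (isOpen_nondegSet p hF)
    (contDiffOn_dt (isOpen_nondegSet p hF) (contDiffOn_density p hF))
    fun θ _ => ⟨⟨by simpa using hδ, trivial⟩, h0 θ⟩).self_of_nhds

end Family

theorem metric_comm (p : ℕ) {n : ℕ} (z w : Fin n → ℂ) : metric p z w = metric p w z := by
  simp only [metric_eq_sum]
  refine Finset.sum_congr rfl fun j _ => ?_
  simp only [Complex.mul_re, Complex.conj_re, Complex.conj_im]
  ring

theorem hasDerivAt_metric (p : ℕ) {n : ℕ} {f g : ℝ → Fin n → ℂ} {f' g' : Fin n → ℂ} {t : ℝ}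
    (hf : HasDerivAt f f' t) (hg : HasDerivAt g g' t) :
    HasDerivAt (fun s => metric p (f s) (g s)) (metric p f' (g t) + metric p (f t) g') t := by
  simp only [metric_eq_sum, ← Finset.sum_add_distrib, ← mul_add]
  refine HasDerivAt.fun_sum fun j _ => HasDerivAt.const_mul _ ?_
  have h1 := hasDerivAt_pi.1 hf j
  have h2 := hasDerivAt_pi.1 hg j
  exact Complex.reCLM.hasFDerivAt.comp_hasDerivAt t
    (h1.mul (Complex.conjCLE.toContinuousLinearMap.hasFDerivAt.comp_hasDerivAt t h2))

/-- The `t`-derivative of the differential of a family in a spatial direction is the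
spatial derivative of the velocity of the family. -/
theorem hasDerivAt_fderiv_family {E F : Type*} [NormedAddCommGroup E] [NormedSpace ℝ E]
    [NormedAddCommGroup F] [NormedSpace ℝ F] {G : ℝ × E → F} {t : ℝ} {x : E}
    (hG : ContDiffAt ℝ ∞ G (t, x)) {Y : E → F} (hY : ∀ y, fderiv ℝ G (t, y) (1, 0) = Y y) (v : E) :
    HasDerivAt (fun s => fderiv ℝ G (s, x) (0, v)) (fderiv ℝ Y x v) t := by
  have hd : DifferentiableAt ℝ (fderiv ℝ G) (t, x) :=
    (hG.fderiv_right (m := ∞) (by simp)).differentiableAt (by simp)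
  have h1 := (hasDerivAt_fst hd).clm_apply (hasDerivAt_const t ((0 : ℝ), v))
  have h2 := ((hasFDerivAt_snd hd).clm_apply (hasFDerivAt_const ((1 : ℝ), (0 : E)) x)).fderiv
  simp only [hY] at h2
  have h2le : ((2 : ℕ∞) : WithTop ℕ∞) ≤ ∞ := WithTop.coe_le_coe.2 le_top
  -- Symmetry of the second derivative exchanges the time direction with the spatial one.
  have hsymm := (hG.isSymmSndFDerivAt (by simpa using h2le)).eq (1, 0) (0, v)
  convert h1 using 1
  rw [h2]
  simp [hsymm]

/-! ### The first variation and H-minimality. -/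

section FirstVariation

variable {n : ℕ} {r : Fin n → ℝ} {X : (Fin n → ℂ) → (Fin n → ℂ)}
  {Φ : ℝ → (Fin n → ℂ) → (Fin n → ℂ)}

theorem contDiffOn_flow_comp {f : (Fin n → ℝ) → (Fin n → ℂ)} (hf : ContDiff ℝ ∞ f)
    {δ : ℝ} {U : Set (Fin n → ℂ)} (hfU : Set.range f ⊆ U)
    (hΦ : ContDiffOn ℝ ∞ (fun q : ℝ × (Fin n → ℂ) => Φ q.1 q.2) (Set.Ioo (-δ) δ ×ˢ U)) :
    ContDiffOn ℝ ∞ (fun q : ℝ × (Fin n → ℝ) => Φ q.1 (f q.2)) (Set.Ioo (-δ) δ ×ˢ Set.univ) :=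
  hΦ.comp (contDiff_fst.prodMk (hf.comp contDiff_snd)).contDiffOn
    fun q hq => ⟨hq.1, hfU ⟨q.2, rfl⟩⟩

theorem circleProduct_add_single (r θ : Fin n → ℝ) (j : Fin n) :
    circleProduct r (θ + Pi.single j (2 * Real.pi)) = circleProduct r θ := by
  funext i
  obtain rfl | hij := eq_or_ne i j
  · simp [circleProduct, add_mul, Complex.exp_add, Complex.exp_two_pi_mul_I]
  · simp [circleProduct, hij]

/-- The function whose `j`-th partial derivative is the contribution of the `j`-th coordinate to
the first variation of the volume density of the product of circles. -/
def variationPotential (p : ℕ) (r : Fin n → ℝ) (X : (Fin n → ℂ) → (Fin n → ℂ))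
    (H : (Fin n → ℂ) → ℝ) (j : Fin n) (θ : Fin n → ℝ) : ℝ :=
  (X (circleProduct r θ) j * conj (Complex.exp (θ j * Complex.I) * Complex.I)).re
    + sgn p j / r j * H (circleProduct r θ)

theorem contDiff_variationPotential (p : ℕ) {H : (Fin n → ℂ) → ℝ} (hX : ContDiff ℝ ∞ X)
    (hH : ContDiff ℝ ∞ H) (j : Fin n) : ContDiff ℝ ∞ (variationPotential p r X H j) := by
  have h1 := contDiff_pi.1 (hX.comp (contDiff_circleProduct r)) j
  refine ContDiff.add (Complex.reCLM.contDiff.comp (h1.mul (Complex.conjCLE.contDiff.comp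
    ((contDiff_exp_coord j).mul contDiff_const)))) (contDiff_const.mul
      (hH.comp (contDiff_circleProduct r)))

theorem variationPotential_add_single (p : ℕ) {H : (Fin n → ℂ) → ℝ} (j : Fin n)
    (θ : Fin n → ℝ) :
    variationPotential p r X H j (θ + Pi.single j (2 * Real.pi))
      = variationPotential p r X H j θ := by
  simp [variationPotential, circleProduct_add_single, add_mul, Complex.exp_add,
    Complex.exp_two_pi_mul_I]

/-- Differentiating `conj (i e^{iθ_j})` leaves the unwanted term `-Re (X_j · conj (e^{iθ_j}))`. The
Hamiltonian condition gives `∂_j (H ∘ f) = ε_j r_j Re (X_j · conj (e^{iθ_j}))`, with `f` the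
parametrization, so the coefficient `ε_j / r_j` of `H` cancels it. -/
theorem fderiv_variationPotential (p : ℕ) (hr : ∀ j, 0 < r j) {H : (Fin n → ℂ) → ℝ}
    (hX : ContDiff ℝ ∞ X) (hH : ContDiff ℝ ∞ H) (hXH : ∀ z v, omega p (X z) v = fderiv ℝ H z v)
    (j : Fin n) (θ : Fin n → ℝ) :
    fderiv ℝ (variationPotential p r X H j) θ (Pi.single j 1)
      = (fderiv ℝ (fun θ => X (circleProduct r θ)) θ (Pi.single j 1) j
          * conj (Complex.exp (θ j * Complex.I) * Complex.I)).re := by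
  have h1 : HasFDerivAt (fun θ => X (circleProduct r θ) j) _ θ := hasFDerivAt_pi'.1
    ((hX.comp (contDiff_circleProduct r)).differentiable (by simp) θ).hasFDerivAt j
  have h2 := (hasFDerivAt_exp_coord θ j).mul_const Complex.I
  have h3 := Complex.reCLM.hasFDerivAt.comp θ (h1.mul
    (Complex.conjCLE.toContinuousLinearMap.hasFDerivAt.comp θ h2))
  have h4 := ((hH.differentiable (by simp) (circleProduct r θ)).hasFDerivAt.comp θ
    (hasFDerivAt_circleProduct r θ)).const_mul (sgn p j / r j)
  have h5 : HasFDerivAt (variationPotential p r X H j) _ θ := h3.add h4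
  -- The Hamiltonian condition tested on the `j`-th coordinate tangent vector, of which only
  -- coordinate `j` is nonzero.
  have h6 := hXH (circleProduct r θ) (circleProductDeriv r θ (Pi.single j 1))
  rw [omega_eq_sum, Finset.sum_eq_single j] at h6
  rotate_left
  · intro k _ hk
    simp [circleProductDeriv_apply, Pi.single_eq_of_ne hk]
  · simp
  rw [h5.fderiv]
  simp only [circleProductDeriv_apply, Pi.single_eq_same, Complex.ofReal_one, one_mul] at h6
  have hrs : sgn p j / r j * (sgn p j * r j) = 1 := by
    have := (hr j).ne'
    field_simp
    rw [pow_two, sgn_mul_self]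
  simp only [Function.comp_def, add_apply, ContinuousLinearMap.comp_apply,
    smul_apply, ← h6]
  simp
  linear_combination ((X (circleProduct r θ) j).re * Real.cos (θ j)
    + (X (circleProduct r θ) j).im * Real.sin (θ j)) * hrs

/-- The logarithmic derivative of the density at a diagonal metric is half the sum of `g'_jj /
g_jj`, and the two equal terms of `g'_jj` absorb the half. The flow equation is needed only at time
zero. -/
theorem dt_density_flow (p : ℕ) (hr : ∀ j, 0 < r j) {H : (Fin n → ℂ) → ℝ}
    (hX : ContDiff ℝ ∞ X) (hH : ContDiff ℝ ∞ H) (hXH : ∀ z v, omega p (X z) v = fderiv ℝ H z v)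
    {δ : ℝ} (hδ : 0 < δ) {U : Set (Fin n → ℂ)} (hU : Set.range (circleProduct r) ⊆ U)
    (hΦ : ContDiffOn ℝ ∞ (fun q : ℝ × (Fin n → ℂ) => Φ q.1 q.2) (Set.Ioo (-δ) δ ×ˢ U))
    (hΦ0 : ∀ z ∈ U, Φ 0 z = z) (hflow : ∀ z ∈ U, HasDerivAt (fun s => Φ s z) (X (Φ 0 z)) 0)
    (θ : Fin n → ℝ) :
    dt (density p fun t θ => Φ t (circleProduct r θ)) (0, θ)
      = ∑ j, √|∏ i, sgn p i * r i ^ 2| / r j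
          * fderiv ℝ (variationPotential p r X H j) θ (Pi.single j 1) := by
  set F : ℝ → (Fin n → ℝ) → (Fin n → ℂ) := fun t θ => Φ t (circleProduct r θ)
  have hF := contDiffOn_flow_comp (contDiff_circleProduct r) hU hΦ
  have ho : IsOpen (Set.Ioo (-δ) δ ×ˢ (Set.univ : Set (Fin n → ℝ))) := isOpen_Ioo.prod isOpen_univ
  have hsm : ∀ t ∈ Set.Ioo (-δ) δ, ∀ θ, ContDiffAt ℝ ∞
      (fun q : ℝ × (Fin n → ℝ) => F q.1 q.2) (t, θ) :=
    fun t ht θ => hF.contDiffAt (ho.mem_nhds ⟨ht, trivial⟩)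
  have h0 : (0 : ℝ) ∈ Set.Ioo (-δ) δ := by simpa using hδ
  have hF0 : F 0 = circleProduct r := funext fun θ => hΦ0 _ (hU ⟨θ, rfl⟩)
  have hvel : ∀ y, fderiv ℝ (fun q : ℝ × (Fin n → ℝ) => F q.1 q.2) (0, y) (1, 0)
      = X (circleProduct r y) := fun y => by
    have h1 := hasDerivAt_fst ((hsm 0 h0 y).differentiableAt (by simp))
    have h2 := hflow _ (hU ⟨y, rfl⟩)
    rw [hΦ0 _ (hU ⟨y, rfl⟩)] at h2
    exact h1.unique h2
  have hsnd : ∀ v, fderiv ℝ (fun q : ℝ × (Fin n → ℝ) => F q.1 q.2) (0, θ) (0, v)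
      = circleProductDeriv r θ v := fun v => by
    have h1 := hasFDerivAt_snd ((hsm 0 h0 θ).differentiableAt (by simp))
    simp only [hF0] at h1
    simpa using congrArg (fun L => L v) (h1.unique (hasFDerivAt_circleProduct r θ))
  -- The tangent vectors of the moving torus vary at the rate given by the derivative of `X` along
  -- the torus.
  have hW := fun v => hasDerivAt_fderiv_family (hsm 0 h0 θ) hvel v
  have hentry : ∀ i j, HasDerivAt (fun s => inducedMetric p (F s) θ i j)
      (Matrix.of (fun i j => metric p (fderiv ℝ (fun θ => X (circleProduct r θ)) θ (Pi.single i 1))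
          (circleProductDeriv r θ (Pi.single j 1))
        + metric p (circleProductDeriv r θ (Pi.single i 1))
          (fderiv ℝ (fun θ => X (circleProduct r θ)) θ (Pi.single j 1))) i j) 0 := fun i j => by
    have := hasDerivAt_metric p (hW (Pi.single i 1)) (hW (Pi.single j 1))
    rw [hsnd, hsnd] at this
    refine this.congr_of_eventuallyEq ?_
    filter_upwards [isOpen_Ioo.mem_nhds h0] with s hs
    exact inducedMetric_family p ((hsm s hs θ).differentiableAt (by simp)) i j
  have hdiag : inducedMetric p (F 0) θ = Matrix.diagonal fun j => sgn p j * r j ^ 2 := by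
    rw [hF0, inducedMetric_circleProduct]
  have hdet0 : (inducedMetric p (F 0) θ).det ≠ 0 := by
    rw [hF0]; exact det_inducedMetric_circleProduct_ne_zero r p hr θ
  have hD := hasDerivAt_sqrt_abs (hasDerivAt_det_of_diagonal hentry hdiag) hdet0
  have hdt := hasDerivAt_dt (isOpen_nondegSet p hF) (contDiffOn_density p hF)
    (t := 0) (x := θ) ⟨⟨h0, trivial⟩, hdet0⟩
  rw [hdt.unique hD, hdiag, Matrix.det_diagonal, Finset.sum_div, Finset.mul_sum]
  refine Finset.sum_congr rfl fun j _ => ?_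
  have hprod := Finset.mul_prod_erase Finset.univ (fun i => sgn p i * r i ^ 2) (Finset.mem_univ j)
  have hne : ∏ i ∈ Finset.univ.erase j, (sgn p i * r i ^ 2) ≠ 0 := Finset.prod_ne_zero_iff.2
    fun i _ => mul_ne_zero (sgn_ne_zero p i) (pow_pos (hr i) 2).ne'
  rw [← hprod, fderiv_variationPotential p hr hX hH hXH, Matrix.of_apply, metric_comm p
    (circleProductDeriv r θ (Pi.single j 1)), metric_eq_sum, Finset.sum_eq_single j]
  rotate_left
  · intro k _ hk
    simp [circleProductDeriv_apply, Pi.single_eq_of_ne hk]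
  · simp
  have hrj := (hr j).ne'
  have hsj := sgn_ne_zero p j
  have : ∀ w : ℂ, (w * conj (circleProductDeriv r θ (Pi.single j 1) j)).re
      = r j * (w * conj (Complex.exp (θ j * Complex.I) * Complex.I)).re := fun w => by
    rw [← Complex.re_ofReal_mul, circleProductDeriv_apply]
    congr 1
    simp
    ring
  rw [this]
  field_simp
  ring

/-- The coefficients `√|det| / r_j` are constant on the torus, so each summand is a constant times a
partial derivative of a periodic function. -/
theorem isHMinimal_circleProduct (p : ℕ) (hr : ∀ j, 0 < r j) : IsHMinimal p (circleProduct r) := by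
  refine ⟨det_inducedMetric_circleProduct_ne_zero r p hr, ?_⟩
  rintro X ⟨hX, -, H, hH, hXH⟩ Φ ⟨δ, hδ, U, hU, hLU, hΦ, hΦ0, hflow⟩
  have h0 : (0 : ℝ) ∈ Set.Ioo (-δ) δ := by simpa using hδ
  have hF0 : (fun θ => Φ 0 (circleProduct r θ)) = circleProduct r :=
    funext fun θ => hΦ0 _ (hLU ⟨θ, rfl⟩)
  have key := (eventually_hasDerivAt_vol p (F := fun t θ => Φ t (circleProduct r θ))
    (contDiffOn_flow_comp (contDiff_circleProduct r) hLU hΦ) hδ (by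
      rw [hF0]; exact det_inducedMetric_circleProduct_ne_zero r p hr)).self_of_nhds
  convert key using 1
  simp_rw [dt_density_flow p hr hX hH hXH hδ hLU hΦ hΦ0 (hflow 0 h0)]
  have hsm := fun j => contDiff_variationPotential (r := r) p hX hH j
  rw [integral_finsetSum]
  · refine (Finset.sum_eq_zero fun j _ => ?_).symm
    rw [integral_const_mul, integral_box_fderiv_single_eq_zero
      ((hsm j).of_le (by exact_mod_cast le_top)) j
      (variationPotential_add_single p j), mul_zero]
  · intro j _
    refine Integrable.const_mul ?_ _
    exact (((hsm j).continuous_fderiv (by simp)).clm_apply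
      continuous_const).continuousOn.integrableOn_compact isCompact_Icc

end FirstVariation

/-! ### Hamiltonian vector fields -/

/-- The Hamiltonian vector field of the function `H`. -/
def hamField (p : ℕ) {n : ℕ} (H : (Fin n → ℂ) → ℝ) (z : Fin n → ℂ) : Fin n → ℂ := fun j =>
  -Complex.I * sgn p j * (((fderiv ℝ H z (Pi.single j 1) : ℝ) : ℂ)
    + Complex.I * ((fderiv ℝ H z (Pi.single j Complex.I) : ℝ) : ℂ))

theorem omega_hamField (p : ℕ) {n : ℕ} (H : (Fin n → ℂ) → ℝ) (z v : Fin n → ℂ) :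
    omega p (hamField p H z) v = fderiv ℝ H z v := by
  -- In the real basis `e_j`, `i e_j` the identity splits into one identity per coordinate, where
  -- `ε_j² = 1` removes the sign.
  have hv : v = ∑ j, ((v j).re • (Pi.single j 1 : Fin n → ℂ)
      + (v j).im • (Pi.single j Complex.I : Fin n → ℂ)) := by
    funext k
    simp [Finset.sum_apply, Pi.single_apply, Finset.sum_add_distrib, Complex.re_add_im]
  conv_rhs => rw [hv]
  rw [omega_eq_sum, map_sum]
  refine Finset.sum_congr rfl fun j _ => ?_
  simp only [map_add, map_smul, hamField, smul_eq_mul]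
  have : Complex.I * (-Complex.I * sgn p j * (fderiv ℝ H z (Pi.single j 1)
        + Complex.I * fderiv ℝ H z (Pi.single j Complex.I))) * conj (v j)
      = sgn p j * ((fderiv ℝ H z (Pi.single j 1)
        + Complex.I * fderiv ℝ H z (Pi.single j Complex.I)) * conj (v j)) := by
    linear_combination (-(sgn p j * ((fderiv ℝ H z (Pi.single j 1)
        + Complex.I * fderiv ℝ H z (Pi.single j Complex.I)) * conj (v j))) : ℂ) * Complex.I_mul_I
  rw [this, Complex.re_ofReal_mul, ← mul_assoc, sgn_mul_self]
  simp
  ring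

theorem isHamiltonian_hamField (p : ℕ) {n : ℕ} {H : (Fin n → ℂ) → ℝ} (hH : ContDiff ℝ ∞ H)
    (hc : HasCompactSupport H) : IsHamiltonian p (hamField p H) where
  smooth := by
    have h : ∀ v, ContDiff ℝ ∞ fun z => ((fderiv ℝ H z v : ℝ) : ℂ) := fun v =>
      Complex.ofRealCLM.contDiff.comp ((hH.fderiv_right (by simp)).clm_apply contDiff_const)
    exact contDiff_pi.2 fun j => contDiff_const.mul ((h _).add (contDiff_const.mul (h _)))
  compactSupport := by
    refine (hc.fderiv (𝕜 := ℝ)).mono' fun z hz => ?_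
    by_contra hcon
    have h0 := image_eq_zero_of_notMem_tsupport hcon
    refine hz (funext fun j => ?_)
    simp [hamField, h0]
  exact_form := ⟨H, hH, omega_hamField p H⟩

/-- A smooth function on a neighbourhood of a compact set agrees near the compact set with a
compactly supported smooth function. -/
theorem exists_contDiff_hasCompactSupport_eqOn {E : Type*} [NormedAddCommGroup E] [NormedSpace ℝ E]
    [FiniteDimensional ℝ E] {K O : Set E} (hK : IsCompact K) (hO : IsOpen O) (hKO : K ⊆ O)
    {h : E → ℝ} (hh : ContDiffOn ℝ ∞ h O) :
    ∃ H : E → ℝ, ContDiff ℝ ∞ H ∧ HasCompactSupport H ∧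
      ∃ W, IsOpen W ∧ K ⊆ W ∧ W ⊆ O ∧ Set.EqOn H h W := by
  obtain ⟨L, hL, hKL, hLO⟩ := exists_compact_between hK hO hKO
  obtain ⟨χ, h1, h0, -⟩ := exists_contMDiffMap_one_nhds_of_subset_interior (n := ⊤)
    (modelWithCornersSelf ℝ E) hK.isClosed hKL
  have hχ : ContDiff ℝ ∞ χ := χ.contMDiff.contDiff
  have hts : tsupport χ ⊆ L := closure_minimal (fun x hx => by
    by_contra hcon; exact hx (h0 x hcon)) hL.isClosed
  obtain ⟨W, hW, hKW, hW1⟩ := mem_nhdsSet_iff_exists.1 h1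
  refine ⟨fun x => χ x * h x, contDiff_iff_contDiffAt.2 fun x => ?_, ?_, W ∩ O, hW.inter hO,
    Set.subset_inter hKW hKO, Set.inter_subset_right, fun x hx => ?_⟩
  · by_cases hx : x ∈ tsupport χ
    · exact hχ.contDiffAt.mul (hh.contDiffAt (hO.mem_nhds (hLO (hts hx))))
    · refine (contDiffAt_const (c := (0 : ℝ))).congr_of_eventuallyEq ?_
      filter_upwards [(isClosed_tsupport χ).isOpen_compl.mem_nhds hx] with y hy
      rw [image_eq_zero_of_notMem_tsupport hy, zero_mul]
  · exact HasCompactSupport.of_support_subset_isCompact hL fun x hx => by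
      by_contra hcon
      exact hx (by simp [h0 x hcon])
  · have : χ x = 1 := hW1 hx.1
    simp [this]

/-! ### The phase function -/

/-- The differential of the argument at `z`. -/
def argForm (z : ℂ) : ℂ →L[ℝ] ℝ :=
  (‖z‖ ^ 2)⁻¹ • Complex.imCLM.comp (ContinuousLinearMap.mul ℝ ℂ (conj z))

theorem argForm_apply (z v : ℂ) : argForm z v = (‖z‖ ^ 2)⁻¹ * (conj z * v).im := by
  simp [argForm]

/-- `z / |z|`. -/
def unitVec (z : ℂ) : ℂ := ‖z‖⁻¹ • z

theorem hasFDerivAt_norm_complex {z : ℂ} (hz : z ≠ 0) :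
    HasFDerivAt (fun z : ℂ => ‖z‖)
      (‖z‖⁻¹ • Complex.reCLM.comp (ContinuousLinearMap.mul ℝ ℂ (conj z))) z := by
  have hz' : ‖z‖ ≠ 0 := norm_ne_zero_iff.2 hz
  have h := (hasStrictFDerivAt_norm_sq z).hasFDerivAt.sqrt (pow_ne_zero 2 hz')
  simp only [Real.sqrt_sq (norm_nonneg _)] at h
  refine h.congr_fderiv ?_
  ext v
  simp [Complex.inner]
  field_simp

/-- This is `d(e^{iα}) = i e^{iα} dα` with `argForm z` in the role of `dα`, so no branch of the
argument has to be chosen. -/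
theorem hasFDerivAt_unitVec {z : ℂ} (hz : z ≠ 0) :
    HasFDerivAt unitVec ((unitVec z * Complex.I) • Complex.ofRealCLM.comp (argForm z)) z := by
  have hz' : ‖z‖ ≠ 0 := norm_ne_zero_iff.2 hz
  have h := ((hasDerivAt_inv hz').comp_hasFDerivAt z (hasFDerivAt_norm_complex hz)).smul
    (hasFDerivAt_id z)
  refine h.congr_fderiv (ContinuousLinearMap.ext fun v => ?_)
  have hzz : z * conj z = (‖z‖ : ℂ) ^ 2 := Complex.mul_conj' z
  have hre := Complex.re_add_im (conj z * v)
  have hc : (‖z‖ : ℂ) ≠ 0 := by exact_mod_cast hz'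
  simp only [add_apply, smul_apply, ContinuousLinearMap.smulRight_apply, argForm_apply, unitVec,
    ContinuousLinearMap.comp_apply, Complex.ofRealCLM_apply, Complex.real_smul, smul_eq_mul,
    Function.comp_apply, ContinuousLinearMap.mul_apply', Complex.reCLM_apply, id_eq,
    ContinuousLinearMap.coe_id']
  push_cast
  generalize (conj z * v).re = a at *
  generalize (conj z * v).im = b at *
  field_simp
  linear_combination (-z) * hre - v * hzz

theorem contDiffAt_unitVec {z : ℂ} (hz : z ≠ 0) : ContDiffAt ℝ ∞ unitVec z :=
  ((contDiffAt_norm ℝ hz).inv (norm_ne_zero_iff.2 hz)).smul contDiffAt_id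

theorem unitVec_smul {c : ℝ} (hc : 0 < c) (z : ℂ) : unitVec (c • z) = unitVec z := by
  rw [unitVec, unitVec, norm_smul, Real.norm_of_nonneg hc.le, smul_smul]
  congr 1
  field_simp

section Phase

variable {n : ℕ}

/-- `∏ (z_j / |z_j|) ^ m_j`. -/
def phase (m : Fin n → ℕ) (z : Fin n → ℂ) : ℂ := ∏ j, unitVec (z j) ^ m j

/-- The complement of the coordinate hyperplanes. -/
def coordCompl (n : ℕ) : Set (Fin n → ℂ) := {z | ∀ j, z j ≠ 0}

theorem isOpen_coordCompl : IsOpen (coordCompl n) := by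
  simp only [coordCompl, Set.ofPred_forall]
  exact isOpen_iInter_of_finite fun j => isOpen_ne_fun (continuous_apply j) continuous_const

theorem contDiffOn_phase (m : Fin n → ℕ) : ContDiffOn ℝ ∞ (phase m) (coordCompl n) := fun z hz =>
  ContDiffAt.contDiffWithinAt <| contDiffAt_prod fun j _ =>
    ((contDiffAt_unitVec (hz j)).comp z (contDiff_apply ℝ ℂ j).contDiffAt).pow _

/-- Maps satisfying `df = i f a` with a real form `a` are closed under products, and the forms add;
powers and finite products follow by induction. -/
theorem hasFDerivAt_mul_of_argument {E : Type*} [NormedAddCommGroup E] [NormedSpace ℝ E]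
    {f g : E → ℂ} {a b : E →L[ℝ] ℝ} {z : E}
    (hf : HasFDerivAt f ((f z * Complex.I) • Complex.ofRealCLM.comp a) z)
    (hg : HasFDerivAt g ((g z * Complex.I) • Complex.ofRealCLM.comp b) z) :
    HasFDerivAt (fun z => f z * g z)
      ((f z * g z * Complex.I) • Complex.ofRealCLM.comp (a + b)) z := by
  refine (hf.mul hg).congr_fderiv ?_
  ext v
  simp
  ring

theorem hasFDerivAt_pow_of_argument {E : Type*} [NormedAddCommGroup E] [NormedSpace ℝ E]
    {f : E → ℂ} {a : E →L[ℝ] ℝ} {z : E}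
    (hf : HasFDerivAt f ((f z * Complex.I) • Complex.ofRealCLM.comp a) z) (k : ℕ) :
    HasFDerivAt (fun z => f z ^ k)
      ((f z ^ k * Complex.I) • Complex.ofRealCLM.comp ((k : ℝ) • a)) z := by
  induction k with
  | zero =>
    simp only [pow_zero]
    exact (hasFDerivAt_const (𝕜 := ℝ) (1 : ℂ) z).congr_fderiv (by ext v; simp)
  | succ k ih =>
    simp only [pow_succ]
    refine (hasFDerivAt_mul_of_argument ih hf).congr_fderiv ?_
    congr 2
    ext v
    simp
    ring

theorem hasFDerivAt_prod_of_argument {E ι : Type*} [NormedAddCommGroup E] [NormedSpace ℝ E]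
    {f : ι → E → ℂ} {a : ι → E →L[ℝ] ℝ} {z : E} (s : Finset ι)
    (hf : ∀ i, HasFDerivAt (f i) ((f i z * Complex.I) • Complex.ofRealCLM.comp (a i)) z) :
    HasFDerivAt (fun z => ∏ i ∈ s, f i z)
      (((∏ i ∈ s, f i z) * Complex.I) • Complex.ofRealCLM.comp (∑ i ∈ s, a i)) z := by
  classical
  induction s using Finset.induction_on with
  | empty =>
    simp only [Finset.prod_empty]
    exact (hasFDerivAt_const (𝕜 := ℝ) (1 : ℂ) z).congr_fderiv (by ext v; simp)
  | insert i s hi ih =>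
    simp only [Finset.prod_insert hi, Finset.sum_insert hi]
    exact hasFDerivAt_mul_of_argument (hf i) ih

theorem fderiv_re_phase_apply (m : Fin n → ℕ) {z : Fin n → ℂ} (hz : z ∈ coordCompl n)
    (v : Fin n → ℂ) :
    fderiv ℝ (fun z => (phase m z).re) z v
      = -(phase m z).im * ∑ j, m j * argForm (z j) (v j) := by
  have h1 : ∀ j, HasFDerivAt (fun z : Fin n → ℂ => unitVec (z j))
      ((unitVec (z j) * Complex.I) • Complex.ofRealCLM.comp
        ((argForm (z j)).comp (ContinuousLinearMap.proj j))) z := fun j =>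
    HasFDerivAt.comp (g := unitVec) (f := fun z : Fin n → ℂ => z j) z
      (hasFDerivAt_unitVec (hz j)) (hasFDerivAt_apply j z)
  have h2 := hasFDerivAt_prod_of_argument Finset.univ
    fun j => hasFDerivAt_pow_of_argument (h1 j) (m j)
  have h3 : HasFDerivAt (fun z => (phase m z).re) _ z := Complex.reCLM.hasFDerivAt.comp z h2
  rw [h3.fderiv]
  have h4 : (∏ i, unitVec (z i) ^ m i) = phase m z := rfl
  simp [h4, Complex.mul_re]

/-! ### The Hamiltonian flow of the phase. -/

/-- The rate of change of `log |z_j|` under the Hamiltonian flow of the real part of the phase,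
up to sign. -/
def rate (p : ℕ) (m : Fin n → ℕ) (z : Fin n → ℂ) (j : Fin n) : ℝ :=
  sgn p j * m j * (phase m z).im / ‖z j‖ ^ 2

theorem contDiffOn_rate (p : ℕ) (m : Fin n → ℕ) (j : Fin n) :
    ContDiffOn ℝ ∞ (fun z => rate p m z j) (coordCompl n) := by
  refine ContDiffOn.div (contDiffOn_const.mul
    (Complex.imCLM.contDiff.comp_contDiffOn (contDiffOn_phase m))) ?_ fun z hz =>
      pow_ne_zero 2 (norm_ne_zero_iff.2 (hz j))
  exact ((contDiff_norm_sq ℝ).comp (contDiff_apply ℝ ℂ j)).contDiffOn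

/-- The function varies only with the arguments, so its gradient is tangent to the coordinate
circles, and multiplication by `-i` turns it radial. -/
theorem hamField_of_eqOn (p : ℕ) (m : Fin n → ℕ) {H : (Fin n → ℂ) → ℝ} {W : Set (Fin n → ℂ)}
    (hW : IsOpen W) (hWO : W ⊆ coordCompl n) (hH : Set.EqOn H (fun z => (phase m z).re) W)
    {z : Fin n → ℂ} (hz : z ∈ W) : hamField p H z = fun j => (-rate p m z j) • z j := by
  funext j
  have heq : fderiv ℝ H z = fderiv ℝ (fun z => (phase m z).re) z :=
    (Filter.eventuallyEq_of_mem (hW.mem_nhds hz) hH).fderiv_eq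
  have hs : ∀ w : ℂ, ∑ k, (m k : ℝ) * argForm (z k) ((Pi.single j w : Fin n → ℂ) k)
      = m j * argForm (z j) w := fun w => by
    rw [Finset.sum_eq_single j] <;> simp +contextual [Pi.single_eq_of_ne]
  rw [hamField, heq, fderiv_re_phase_apply m (hWO hz), fderiv_re_phase_apply m (hWO hz), hs, hs,
    argForm_apply, argForm_apply, rate, Complex.real_smul]
  simp only [mul_one, Complex.conj_im, Complex.mul_im, Complex.conj_re, Complex.I_im, Complex.I_re,
    mul_zero, add_zero]
  push_cast
  linear_combination (sgn p j * (phase m z).im * m j * (z j).re / (‖z j‖ : ℂ) ^ 2 : ℂ)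
    * Complex.I_mul_I - (sgn p j * (phase m z).im * m j / (‖z j‖ : ℂ) ^ 2 : ℂ)
      * Complex.re_add_im (z j)

/-- The Hamiltonian flow of the real part of the phase. -/
def phaseFlow (p : ℕ) (m : Fin n → ℕ) (t : ℝ) (z : Fin n → ℂ) : Fin n → ℂ :=
  fun j => √(1 - 2 * t * rate p m z j) • z j

/-- Positive rescaling of coordinates preserves arguments. With the phase conserved, `|z_j|²` has
constant speed `-2 ε_j m_j Im (phase)`, which explains the square root in `phaseFlow`. -/
theorem phase_phaseFlow (p : ℕ) (m : Fin n → ℕ) {t : ℝ} {z : Fin n → ℂ}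
    (h : ∀ j, 0 < 1 - 2 * t * rate p m z j) : phase m (phaseFlow p m t z) = phase m z := by
  simp only [phase, phaseFlow, unitVec_smul (Real.sqrt_pos.2 (h _))]

theorem rate_phaseFlow (p : ℕ) (m : Fin n → ℕ) {t : ℝ} {z : Fin n → ℂ}
    (h : ∀ j, 0 < 1 - 2 * t * rate p m z j) (j : Fin n) :
    rate p m (phaseFlow p m t z) j = rate p m z j / (1 - 2 * t * rate p m z j) := by
  rw [rate, phase_phaseFlow p m h, phaseFlow, norm_smul, Real.norm_of_nonneg (Real.sqrt_nonneg _),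
    mul_pow, Real.sq_sqrt (h j).le]
  conv_rhs => rw [rate, div_div, mul_comm (‖z j‖ ^ 2)]
  rfl

theorem hasDerivAt_phaseFlow (p : ℕ) (m : Fin n → ℕ) {t : ℝ} {z : Fin n → ℂ}
    (h : ∀ j, 0 < 1 - 2 * t * rate p m z j) :
    HasDerivAt (fun s => phaseFlow p m s z)
      (fun j => (-rate p m (phaseFlow p m t z) j) • phaseFlow p m t z j) t := by
  refine hasDerivAt_pi.2 fun j => ?_
  have h1 : HasDerivAt (fun s : ℝ => 1 - 2 * s * rate p m z j) (-(2 * rate p m z j)) t := by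
    simpa using (((hasDerivAt_id t).const_mul 2).mul_const (rate p m z j)).const_sub 1
  refine ((h1.sqrt (h j).ne').smul_const (z j)).congr_deriv ?_
  rw [rate_phaseFlow p m h, phaseFlow, smul_smul]
  congr 1
  obtain ⟨x, hx, hq⟩ : ∃ x : ℝ, 0 < x ∧ 1 - 2 * t * rate p m z j = x ^ 2 :=
    ⟨_, Real.sqrt_pos.2 (h j), (Real.sq_sqrt (h j).le).symm⟩
  rw [hq, Real.sqrt_sq hx.le]
  field_simp

/-- The domain on which `phaseFlow` is a smooth flow. -/
def phaseFlowDomain (p : ℕ) (m : Fin n → ℕ) : Set (ℝ × (Fin n → ℂ)) :=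
  (Set.univ ×ˢ coordCompl n) ∩ {q | ∀ j, 0 < 1 - 2 * q.1 * rate p m q.2 j}

theorem isOpen_phaseFlowDomain (p : ℕ) (m : Fin n → ℕ) : IsOpen (phaseFlowDomain p m) := by
  have h : ∀ j, ContinuousOn (fun q : ℝ × (Fin n → ℂ) => 1 - 2 * q.1 * rate p m q.2 j)
      (Set.univ ×ˢ coordCompl n) := fun j =>
    continuousOn_const.sub ((by fun_prop : ContinuousOn _ _).mul
      ((contDiffOn_rate p m j).continuousOn.comp continuousOn_snd fun q hq => hq.2))
  have h2 : ContinuousOn (fun (q : ℝ × (Fin n → ℂ)) j => 1 - 2 * q.1 * rate p m q.2 j)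
      (Set.univ ×ˢ coordCompl n) := continuousOn_pi.2 h
  have h3 : IsOpen {x : Fin n → ℝ | ∀ j, 0 < x j} := by
    simp only [Set.ofPred_forall]
    exact isOpen_iInter_of_finite fun j => isOpen_lt continuous_const (continuous_apply j)
  exact h2.isOpen_inter_preimage (isOpen_univ.prod isOpen_coordCompl) h3

theorem contDiffOn_phaseFlow (p : ℕ) (m : Fin n → ℕ) :
    ContDiffOn ℝ ∞ (fun q : ℝ × (Fin n → ℂ) => phaseFlow p m q.1 q.2) (phaseFlowDomain p m) := by
  refine contDiffOn_pi.2 fun j => ContDiffOn.smul (ContDiffOn.sqrt (contDiffOn_const.sub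
    ((contDiffOn_const.mul contDiff_fst.contDiffOn).mul
      ((contDiffOn_rate p m j).comp contDiff_snd.contDiffOn fun q hq => hq.1.2)))
      fun q hq => (hq.2 j).ne') ?_
  exact ((contDiff_apply ℝ ℂ j).comp contDiff_snd).contDiffOn

theorem phaseFlow_zero (p : ℕ) (m : Fin n → ℕ) (z : Fin n → ℂ) : phaseFlow p m 0 z = z := by
  funext j
  simp [phaseFlow]

theorem isFlowNear_phaseFlow (p : ℕ) (m : Fin n → ℕ) {X : (Fin n → ℂ) → (Fin n → ℂ)}
    {K W : Set (Fin n → ℂ)} (hK : IsCompact K) (hW : IsOpen W) (hKW : K ⊆ W)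
    (hWO : W ⊆ coordCompl n) (hX : ∀ z ∈ W, X z = fun j => (-rate p m z j) • z j) :
    IsFlowNear X K (phaseFlow p m) := by
  -- The tube lemma is applied to the times and points for which the formula is defined and its
  -- value still lies in `W`, where the field is known.
  obtain ⟨u, U, hu, hU, h0, hKU, huU⟩ := generalized_tube_lemma
    (isCompact_singleton (x := (0 : ℝ))) hK
    ((contDiffOn_phaseFlow p m).continuousOn.isOpen_inter_preimage (isOpen_phaseFlowDomain p m) hW) (by
        rintro ⟨t, z⟩ ⟨rfl, hz⟩
        refine ⟨⟨⟨trivial, hWO (hKW hz)⟩, fun j => by simp⟩, ?_⟩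
        simpa [phaseFlow_zero] using hKW hz)
  obtain ⟨δ, hδ, hball⟩ := Metric.isOpen_iff.1 hu 0 (h0 rfl)
  rw [Real.ball_eq_Ioo, zero_sub, zero_add] at hball
  have hsub : Set.Ioo (-δ) δ ×ˢ U ⊆ u ×ˢ U := Set.prod_mono hball subset_rfl
  refine ⟨δ, hδ, U, hU, hKU, (contDiffOn_phaseFlow p m).mono fun q hq => (huU (hsub hq)).1,
    fun z _ => phaseFlow_zero p m z, fun t ht z hz => ?_⟩
  have hmem := huU (hsub (Set.mk_mem_prod ht hz))
  rw [hX _ hmem.2]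
  exact hasDerivAt_phaseFlow p m hmem.1.2

/-- At the torus the field is a real multiple of `z_j` in each coordinate while tangent vectors are
real multiples of `i z_j`; hence normality. -/
theorem exists_hamiltonian_phaseFlow (p : ℕ) (m : Fin n → ℕ) {r : Fin n → ℝ}
    (hr : ∀ j, 0 < r j) : ∃ X, IsHamiltonian p X ∧
      (∀ θ v, metric p (X (circleProduct r θ)) (fderiv ℝ (circleProduct r) θ v) = 0) ∧
      IsFlowNear X (Set.range (circleProduct r)) (phaseFlow p m) := by
  have hK := isCompact_range_circleProduct r hr
  have hKO : Set.range (circleProduct r) ⊆ coordCompl n := by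
    rintro _ ⟨θ, rfl⟩ j
    rw [← norm_ne_zero_iff, norm_circleProduct r hr]
    exact (hr j).ne'
  obtain ⟨H, hH, hc, W, hW, hKW, hWO, hHW⟩ := exists_contDiff_hasCompactSupport_eqOn hK
    isOpen_coordCompl hKO (Complex.reCLM.contDiff.comp_contDiffOn (contDiffOn_phase m))
  have hX : ∀ z ∈ W, hamField p H z = fun j => (-rate p m z j) • z j := fun z hz =>
    hamField_of_eqOn p m hW hWO hHW hz
  refine ⟨hamField p H, isHamiltonian_hamField p hH hc, fun θ v => ?_,
    isFlowNear_phaseFlow p m hK hW hKW hWO hX⟩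
  rw [hX _ (hKW ⟨θ, rfl⟩), metric_eq_sum]
  refine Finset.sum_eq_zero fun j _ => ?_
  rw [fderiv_circleProduct_apply]
  have : ∀ c : ℝ, c • circleProduct r θ j
        * conj (v j * (r j * (Complex.exp (θ j * Complex.I) * Complex.I)))
      = ((-c * r j ^ 2 * v j : ℝ) : ℂ) * Complex.I := fun c => by
    simp only [circleProduct, map_mul, Complex.conj_ofReal, Complex.conj_I, Complex.real_smul]
    push_cast
    linear_combination (-c * r j ^ 2 * v j * Complex.I : ℂ) * exp_mul_conj_exp (θ j)
  rw [this, Complex.re_ofReal_mul, Complex.I_re, mul_zero, mul_zero]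

end Phase

/-! ### Volume density of the moved torus and its second derivative. -/

section Flowed

variable {n : ℕ}

/-- The linear function `∑ m_j θ_j`. -/
def angle (m : Fin n → ℕ) : (Fin n → ℝ) →L[ℝ] ℝ :=
  ∑ j, (m j : ℝ) • (ContinuousLinearMap.proj j : (Fin n → ℝ) →L[ℝ] ℝ)

theorem angle_apply (m : Fin n → ℕ) (θ : Fin n → ℝ) : angle m θ = ∑ j, m j * θ j := by
  simp [angle]

theorem angle_single (m : Fin n → ℕ) (j : Fin n) (x : ℝ) : angle m (Pi.single j x) = m j * x := by
  rw [angle_apply, Finset.sum_eq_single j] <;> simp +contextual [Pi.single_eq_of_ne]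

/-- The square of the `j`-th radius of the torus obtained at time `t` by the flow of the real part
of the phase. -/
def radiusSq (p : ℕ) (m : Fin n → ℕ) (r : Fin n → ℝ) (t : ℝ) (θ : Fin n → ℝ) (j : Fin n) : ℝ :=
  r j ^ 2 - 2 * t * (sgn p j * m j * Real.sin (angle m θ))

theorem phase_circleProduct (m : Fin n → ℕ) {r : Fin n → ℝ} (hr : ∀ j, 0 < r j)
    (θ : Fin n → ℝ) : phase m (circleProduct r θ) = Complex.exp (angle m θ * Complex.I) := by
  have h : ∀ j, unitVec (circleProduct r θ j) = Complex.exp (θ j * Complex.I) := fun j => by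
    rw [unitVec, norm_circleProduct r hr, circleProduct, Complex.real_smul, ← mul_assoc,
      ← Complex.ofReal_mul, inv_mul_cancel₀ (hr j).ne', Complex.ofReal_one, one_mul]
  simp only [phase, h, ← Complex.exp_nat_mul, ← Complex.exp_sum]
  congr 1
  rw [angle_apply, Complex.ofReal_sum, Finset.sum_mul]
  refine Finset.sum_congr rfl fun j _ => ?_
  push_cast
  ring

theorem phaseFlow_circleProduct (p : ℕ) (m : Fin n → ℕ) {r : Fin n → ℝ} (hr : ∀ j, 0 < r j)
    (t : ℝ) (θ : Fin n → ℝ) (j : Fin n) :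
    phaseFlow p m t (circleProduct r θ) j
      = √(radiusSq p m r t θ j) • Complex.exp (θ j * Complex.I) := by
  have hrj := (hr j).ne'
  rw [phaseFlow, rate, phase_circleProduct m hr, norm_circleProduct r hr, circleProduct,
    Complex.exp_ofReal_mul_I_im, ← Complex.real_smul, smul_smul]
  congr 1
  -- The radius `r_j` is moved under the root as `√(r_j²)`.
  nth_rewrite 2 [← Real.sqrt_sq (hr j).le]
  rw [← Real.sqrt_mul' _ (sq_nonneg _), radiusSq]
  congr 1
  field_simp

theorem fderiv_phaseFlow_circleProduct (p : ℕ) (m : Fin n → ℕ) {r : Fin n → ℝ}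
    (hr : ∀ j, 0 < r j) {t : ℝ} {θ : Fin n → ℝ} (hpos : ∀ j, 0 < radiusSq p m r t θ j)
    (v : Fin n → ℝ) (j : Fin n) :
    fderiv ℝ (fun θ => phaseFlow p m t (circleProduct r θ)) θ v j
      = (((-(t * (sgn p j * m j) * Real.cos (angle m θ) * angle m v) / √(radiusSq p m r t θ j) : ℝ)
          : ℂ) + ((√(radiusSq p m r t θ j) * v j : ℝ) : ℂ) * Complex.I) * Complex.exp (θ j * Complex.I) := by
  have h1 : ∀ j, HasFDerivAt (fun θ => radiusSq p m r t θ j) _ θ := fun j =>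
    ((((angle m).hasFDerivAt (x := θ)).sin.const_mul (sgn p j * m j)).const_mul (2 * t)).const_sub
      (r j ^ 2)
  have h2 : ∀ j, HasFDerivAt (fun θ => phaseFlow p m t (circleProduct r θ) j) _ θ := fun j => by
    simp only [phaseFlow_circleProduct p m hr]
    exact ((h1 j).sqrt (hpos j).ne').smul (hasFDerivAt_exp_coord θ j)
  rw [(hasFDerivAt_pi.2 h2).fderiv]
  have hs := Real.sqrt_pos.2 (hpos j)
  simp
  field_simp
  ring

/-- The trace of the Hessian of the phase angle with respect to the metric of the torus at time
`t`. -/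
def hessTrace (p : ℕ) (m : Fin n → ℕ) (r : Fin n → ℝ) (t : ℝ) (θ : Fin n → ℝ) : ℝ :=
  ∑ j, sgn p j * m j ^ 2 / radiusSq p m r t θ j

/-- The derivatives of all radii are proportional to the single covector `angle m`, so radial motion
adds a multiple of `m mᵀ` to the diagonal angular part. -/
theorem inducedMetric_phaseFlow (p : ℕ) (m : Fin n → ℕ) {r : Fin n → ℝ} (hr : ∀ j, 0 < r j)
    {t : ℝ} {θ : Fin n → ℝ} (hpos : ∀ j, 0 < radiusSq p m r t θ j) :
    inducedMetric p (fun θ => phaseFlow p m t (circleProduct r θ)) θ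
      = Matrix.diagonal (fun j => sgn p j * radiusSq p m r t θ j)
        + Matrix.replicateCol Unit (fun j =>
            (t * Real.cos (angle m θ)) ^ 2 * hessTrace p m r t θ * m j)
          * Matrix.replicateRow Unit (fun j => (m j : ℝ)) := by
  ext i j
  rw [inducedMetric, Matrix.of_apply, metric_eq_sum]
  have hterm : ∀ k, sgn p k * (fderiv ℝ (fun θ => phaseFlow p m t (circleProduct r θ)) θ
        (Pi.single i 1) k * conj (fderiv ℝ (fun θ => phaseFlow p m t (circleProduct r θ)) θ
        (Pi.single j 1) k)).re
      = (t * Real.cos (angle m θ)) ^ 2 * (sgn p k * m k ^ 2 / radiusSq p m r t θ k) * m i * m j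
        + sgn p k * radiusSq p m r t θ k * ((Pi.single i 1 : Fin n → ℝ) k
          * (Pi.single j 1 : Fin n → ℝ) k) := fun k => by
    rw [fderiv_phaseFlow_circleProduct p m hr hpos, fderiv_phaseFlow_circleProduct p m hr hpos,
      angle_single, angle_single]
    obtain ⟨x, hx, hq⟩ : ∃ x : ℝ, 0 < x ∧ radiusSq p m r t θ k = x ^ 2 :=
      ⟨_, Real.sqrt_pos.2 (hpos k), (Real.sq_sqrt (hpos k).le).symm⟩
    rw [hq, Real.sqrt_sq hx.le]
    have : ∀ a b c d : ℝ, ((a + b * Complex.I) * Complex.exp (θ k * Complex.I)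
        * conj ((c + d * Complex.I) * Complex.exp (θ k * Complex.I)) : ℂ).re = a * c + b * d :=
      fun a b c d => by
        have : ((a + b * Complex.I) * Complex.exp (θ k * Complex.I)
            * conj ((c + d * Complex.I) * Complex.exp (θ k * Complex.I)) : ℂ)
            = (a + b * Complex.I) * conj (c + d * Complex.I : ℂ) := by
          rw [map_mul]
          linear_combination ((a + b * Complex.I) * conj (c + d * Complex.I : ℂ))
            * exp_mul_conj_exp (θ k)
        rw [this]
        simp
    rw [this]
    have hs := sgn_mul_self p k
    field_simp
    linear_combination ((t * Real.cos (angle m θ) * m k) ^ 2 * m i * m j * sgn p k) * hs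
  simp only [hterm, Finset.sum_add_distrib, ← Finset.sum_mul, ← Finset.mul_sum]
  have hcr : ∀ a b : Fin n → ℝ, (Matrix.replicateCol Unit a * Matrix.replicateRow Unit b) i j
      = a i * b j := fun a b => by simp [Matrix.mul_apply]
  rw [Matrix.add_apply, hcr, add_comm, Finset.sum_eq_single i]
  · congr 1
    obtain rfl | hij := eq_or_ne i j
    · simp
    · simp [hij]
  · intro k _ hk
    simp [Pi.single_eq_of_ne hk]
  · simp

/-- By the matrix determinant lemma the rank-one term contributes `hessTrace` twice: from its
coefficient and from the inverse diagonal. The correction is thus a square, and the determinant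
keeps the sign of `∏ ε_j`. -/
theorem density_phaseFlow (p : ℕ) (m : Fin n → ℕ) {r : Fin n → ℝ} (hr : ∀ j, 0 < r j)
    {t : ℝ} {θ : Fin n → ℝ} (hpos : ∀ j, 0 < radiusSq p m r t θ j) :
    density p (fun t θ => phaseFlow p m t (circleProduct r θ)) (t, θ)
      = √((∏ j, radiusSq p m r t θ j)
          * (1 + (t * Real.cos (angle m θ) * hessTrace p m r t θ) ^ 2)) := by
  have hne : ∀ j, sgn p j * radiusSq p m r t θ j ≠ 0 := fun j =>
    mul_ne_zero (sgn_ne_zero p j) (hpos j).ne'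
  have hdet : IsUnit (Matrix.diagonal fun j => sgn p j * radiusSq p m r t θ j).det := by
    rw [Matrix.det_diagonal, isUnit_iff_ne_zero]
    exact Finset.prod_ne_zero_iff.2 fun j _ => hne j
  have hinv : (Matrix.diagonal fun j => sgn p j * radiusSq p m r t θ j)⁻¹
      = Matrix.diagonal fun j => (sgn p j * radiusSq p m r t θ j)⁻¹ := by
    refine Matrix.inv_eq_right_inv ?_
    simp only [Matrix.diagonal_mul_diagonal, mul_inv_cancel₀ (hne _), Matrix.diagonal_one]
  rw [density, inducedMetric_phaseFlow p m hr hpos,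
    Matrix.det_add_replicateCol_mul_replicateRow hdet, Matrix.det_diagonal,
    Finset.prod_mul_distrib, hinv, Matrix.det_unique, abs_mul, abs_mul, Finset.abs_prod]
  simp only [abs_sgn, Finset.prod_const_one, one_mul]
  rw [abs_of_pos (Finset.prod_pos fun j _ => hpos j), Matrix.add_apply, Matrix.one_apply_eq,
    Matrix.mul_apply]
  have hsum : ∑ j, (Matrix.replicateRow Unit (fun j => (m j : ℝ))
        * Matrix.diagonal fun j => (sgn p j * radiusSq p m r t θ j)⁻¹) default j
        * Matrix.replicateCol Unit (fun j =>
            (t * Real.cos (angle m θ)) ^ 2 * hessTrace p m r t θ * m j) j default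
      = (t * Real.cos (angle m θ) * hessTrace p m r t θ) ^ 2 := by
    have : (t * Real.cos (angle m θ) * hessTrace p m r t θ) ^ 2
        = (t * Real.cos (angle m θ)) ^ 2 * hessTrace p m r t θ * hessTrace p m r t θ := by ring
    rw [this]
    generalize hT : hessTrace p m r t θ = T
    conv_rhs => arg 2; rw [← hT, hessTrace]
    rw [Finset.mul_sum]
    refine Finset.sum_congr rfl fun j _ => ?_
    have h1 := sgn_mul_self p j
    have h2 := (hpos j).ne'
    have h3 := sgn_ne_zero p j
    rw [Matrix.mul_diagonal, Matrix.replicateRow_apply, Matrix.replicateCol_apply,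
      mul_inv, (eq_inv_of_mul_eq_one_left h1).symm]
    ring
  rw [hsum, abs_of_pos (by positivity)]

/-- The second derivative of `√(∏ (a_i - 2 k_i s) (1 + w(s)²))` at `0`, where `w(0) = 0`. -/
theorem second_deriv_sqrt_prod {ι : Type*} [Fintype ι] [DecidableEq ι] {a k : ι → ℝ}
    (ha : ∀ i, 0 < a i) {w : ℝ → ℝ} (hw : ContDiffAt ℝ ∞ w 0) (hw0 : w 0 = 0) {I I1 : ℝ → ℝ}
    {c : ℝ} (hI : I =ᶠ[𝓝 0] fun s => √((∏ i, (a i - 2 * s * k i)) * (1 + w s ^ 2)))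
    (hI1 : ∀ᶠ s in 𝓝 0, HasDerivAt I (I1 s) s) (hc : HasDerivAt I1 c 0) :
    c = √(∏ i, a i) * ((∑ i, k i / a i) ^ 2 - 2 * ∑ i, (k i / a i) ^ 2 + deriv w 0 ^ 2) := by
  -- `L` is the logarithmic derivative of the root, so the first derivative is `I L` and the second,
  -- at zero, is `I (L² + L')`.
  set L : ℝ → ℝ := fun s => -(∑ i, k i / (a i - 2 * s * k i)) + w s * (deriv w s / (1 + w s ^ 2))
    with hL
  have hlin : ∀ i s, HasDerivAt (fun s => a i - 2 * s * k i) (-(2 * k i)) s := fun i s => by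
    simpa using (((hasDerivAt_id s).const_mul 2).mul_const (k i)).const_sub (a i)
  have hpos : ∀ᶠ s in 𝓝 (0 : ℝ), ∀ i, 0 < a i - 2 * s * k i :=
    Filter.eventually_all.2 fun i => (hlin i 0).continuousAt.eventually_const_lt (by simpa using ha i)
  have hwd : ∀ᶠ s in 𝓝 (0 : ℝ), HasDerivAt w (deriv w s) s :=
    (hw.of_le (show ((1 : ℕ∞) : WithTop ℕ∞) ≤ ∞ from WithTop.coe_le_coe.2 le_top)).eventually
      (by simp) |>.mono fun s hs => (hs.differentiableAt (by simp)).hasDerivAt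
  have hI1L : I1 =ᶠ[𝓝 0] fun s => I s * L s := by
    filter_upwards [hI.eventually_nhds, hI, hI1, hpos, hwd] with s hs hs0 h1 hp hws
    have hprod := HasDerivAt.fun_finsetProd (u := Finset.univ) fun i _ => hlin i s
    have hP : 0 < ∏ i, (a i - 2 * s * k i) := Finset.prod_pos fun i _ => hp i
    have hD : HasDerivAt (fun y => (∏ i, (a i - 2 * y * k i)) * (1 + w y ^ 2))
        ((∑ i, (∏ j ∈ Finset.univ.erase i, (a j - 2 * s * k j)) • -(2 * k i)) * (1 + w s ^ 2)
          + (∏ i, (a i - 2 * s * k i)) * (2 * w s * deriv w s)) s :=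
      (hprod.mul ((hws.pow 2).const_add 1)).congr_deriv (by simp)
    have hQ : 0 < 1 + w s ^ 2 := by positivity
    have hsq := hD.sqrt (mul_pos hP hQ).ne'
    rw [h1.unique (hsq.congr_of_eventuallyEq hs), hs0]
    simp only [hL]
    have hsum : ∑ i, (∏ j ∈ Finset.univ.erase i, (a j - 2 * s * k j)) • (-(2 * k i))
        = (∏ i, (a i - 2 * s * k i)) * (-2 * ∑ i, k i / (a i - 2 * s * k i)) := by
      rw [Finset.mul_sum, Finset.mul_sum]
      refine Finset.sum_congr rfl fun i _ => ?_
      rw [← Finset.mul_prod_erase _ _ (Finset.mem_univ i), smul_eq_mul]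
      have := (hp i).ne'
      field_simp
    rw [hsum]
    generalize ∏ i, (a i - 2 * s * k i) = P at *
    generalize ∑ i, k i / (a i - 2 * s * k i) = A at *
    obtain ⟨x, hx, hq⟩ : ∃ x : ℝ, 0 < x ∧ P * (1 + w s ^ 2) = x ^ 2 :=
      ⟨_, Real.sqrt_pos.2 (mul_pos hP hQ), (Real.sq_sqrt (mul_pos hP hQ).le).symm⟩
    rw [hq, Real.sqrt_sq hx.le]
    rw [div_eq_iff (by positivity)]
    have : x * (-A + w s * (deriv w s / (1 + w s ^ 2))) * (2 * x)
        = 2 * (P * (1 + w s ^ 2)) * (-A + w s * (deriv w s / (1 + w s ^ 2))) := by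
      rw [hq]; ring
    rw [this]
    field_simp
  have hL0 : HasDerivAt L (-(∑ i, 2 * (k i / a i) ^ 2) + deriv w 0 ^ 2) 0 := by
    have h1 : HasDerivAt (fun s => ∑ i, k i / (a i - 2 * s * k i)) (∑ i, 2 * (k i / a i) ^ 2) 0 := by
      refine HasDerivAt.fun_sum fun i _ => ?_
      have hai := (ha i).ne'
      refine ((hasDerivAt_const 0 (k i)).div (hlin i 0) (by simpa using hai)).congr_deriv ?_
      simp
      field_simp
    -- Only differentiability matters here: the value of this derivative is multiplied by `w 0 = 0`.
    have h2 : HasDerivAt (fun s => deriv w s / (1 + w s ^ 2))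
        (deriv (fun s => deriv w s / (1 + w s ^ 2)) 0) 0 := by
      refine (DifferentiableAt.div ?_ ?_ (by positivity)).hasDerivAt
      · have : ContDiffAt ℝ ∞ (fun s => fderiv ℝ w s 1) 0 :=
          (hw.fderiv_right (by simp)).clm_apply contDiffAt_const
        exact this.differentiableAt (by simp)
      · exact ((hw.differentiableAt (by simp)).pow 2).const_add 1
    refine (h1.neg.add (hwd.self_of_nhds.mul h2)).congr_deriv ?_
    simp [hw0]
    ring
  have hfin := (hI1.self_of_nhds.mul hL0).congr_of_eventuallyEq hI1L
  have e1 : I1 0 = I 0 * L 0 := hI1L.self_of_nhds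
  have e2 : I 0 = √(∏ i, a i) := by simpa [hw0] using hI.self_of_nhds
  have e3 : L 0 = -∑ i, k i / a i := by simp [hL, hw0]
  rw [hc.unique hfin, e1, e2, e3, ← Finset.mul_sum]
  ring

theorem dt_dt_density_phaseFlow (p : ℕ) (m : Fin n → ℕ) {r : Fin n → ℝ} (hr : ∀ j, 0 < r j)
    {δ : ℝ} (hδ : 0 < δ) (hF : ContDiffOn ℝ ∞ (fun q : ℝ × (Fin n → ℝ) =>
      phaseFlow p m q.1 (circleProduct r q.2)) (Set.Ioo (-δ) δ ×ˢ Set.univ)) (θ : Fin n → ℝ) :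
    dt (dt (density p fun t θ => phaseFlow p m t (circleProduct r θ))) (0, θ)
      = (∏ j, r j) * (((∑ j, sgn p j * m j / r j ^ 2) ^ 2 - 2 * ∑ j, (m j / r j ^ 2) ^ 2)
          * Real.sin (angle m θ) ^ 2
        + (∑ j, sgn p j * m j ^ 2 / r j ^ 2) ^ 2 * Real.cos (angle m θ) ^ 2) := by
  have hN := isOpen_nondegSet p (F := fun t θ => phaseFlow p m t (circleProduct r θ)) hF
  have hsm := contDiffOn_density p (F := fun t θ => phaseFlow p m t (circleProduct r θ)) hF
  have h0 : ((0 : ℝ), θ) ∈ nondegSet p (fun t θ => phaseFlow p m t (circleProduct r θ)) δ := by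
    refine ⟨⟨by simpa using hδ, trivial⟩, ?_⟩
    change (inducedMetric p (fun θ => phaseFlow p m 0 (circleProduct r θ)) θ).det ≠ 0
    simp only [phaseFlow_zero]
    exact det_inducedMetric_circleProduct_ne_zero r p hr θ
  have hpos : ∀ᶠ s in 𝓝 (0 : ℝ), ∀ j, 0 < radiusSq p m r s θ j :=
    Filter.eventually_all.2 fun j => by
      have : Continuous fun s => radiusSq p m r s θ j := by unfold radiusSq; fun_prop
      exact this.continuousAt.eventually_const_lt (by simpa [radiusSq] using pow_pos (hr j) 2)
  have hhess : ContDiffAt ℝ ∞ (fun s => hessTrace p m r s θ) 0 := by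
    refine ContDiffAt.sum fun j _ => ContDiffAt.div contDiffAt_const ?_ ?_
    · unfold radiusSq; fun_prop
    · simpa [radiusSq] using (hr j).ne'
  have hw : ContDiffAt ℝ ∞ (fun s => s * Real.cos (angle m θ) * hessTrace p m r s θ) 0 :=
    (contDiffAt_id.mul contDiffAt_const).mul hhess
  have hev : ∀ᶠ s in 𝓝 (0 : ℝ),
      (s, θ) ∈ nondegSet p (fun t θ => phaseFlow p m t (circleProduct r θ)) δ :=
    (Continuous.prodMk_left θ).continuousAt.eventually (hN.mem_nhds h0)
  -- The `sin²` terms come from the product of squared radii, the `cos²` term from the rank-one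
  -- correction, whose root has derivative `cos · hessTrace` at zero.
  have key := second_deriv_sqrt_prod (a := fun j => r j ^ 2)
    (k := fun j => sgn p j * m j * Real.sin (angle m θ)) (fun j => pow_pos (hr j) 2) hw (by simp)
    (hpos.mono fun s hs => density_phaseFlow p m hr hs)
    (hev.mono fun s hs => hasDerivAt_dt hN hsm hs) (hasDerivAt_dt hN (contDiffOn_dt hN hsm) h0)
  have hw' : deriv (fun s => s * Real.cos (angle m θ) * hessTrace p m r s θ) 0
      = Real.cos (angle m θ) * ∑ j, sgn p j * m j ^ 2 / r j ^ 2 := by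
    have : HasDerivAt (fun s => s * Real.cos (angle m θ) * hessTrace p m r s θ) _ 0 :=
      ((hasDerivAt_id (0 : ℝ)).mul_const (Real.cos (angle m θ))).mul
        (hhess.differentiableAt (by simp)).hasDerivAt
    rw [this.deriv]
    simp [hessTrace, radiusSq]
  have hsq : ∀ j, (sgn p j * m j * Real.sin (angle m θ) / r j ^ 2) ^ 2
      = Real.sin (angle m θ) ^ 2 * (m j / r j ^ 2) ^ 2 := fun j => by
    linear_combination (Real.sin (angle m θ) ^ 2 * (m j / r j ^ 2) ^ 2) * sgn_mul_self p j
  have hlin : ∑ j, sgn p j * m j * Real.sin (angle m θ) / r j ^ 2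
      = (∑ j, sgn p j * m j / r j ^ 2) * Real.sin (angle m θ) := by
    rw [Finset.sum_mul]
    exact Finset.sum_congr rfl fun j _ => by ring
  rw [key, hw', hlin, Finset.sum_congr rfl fun j _ => hsq j, ← Finset.mul_sum, Finset.prod_pow,
    Real.sqrt_sq (Finset.prod_nonneg fun j _ => (hr j).le)]
  ring

end Flowed

/-! ### Averaging over the torus and the choice of destabilizing directions. -/

section Instability

variable {n : ℕ}

/-- The integrand is, up to the nonzero factor `2 m_a`, the `θ_a`-derivative of the periodic
function `sin (2 ∑ m_j θ_j)`. -/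
theorem integral_box_cos_two_mul_angle (m : Fin n → ℕ) {a : Fin n} (ha : m a ≠ 0) :
    ∫ θ in box n, Real.cos (2 * angle m θ) = 0 := by
  have hd : ∀ θ, HasFDerivAt (fun θ => Real.sin (2 * angle m θ))
      (Real.cos (2 * angle m θ) • (2 : ℝ) • angle m) θ := fun θ =>
    ((angle m).hasFDerivAt.const_mul 2).sin
  have h := integral_box_fderiv_single_eq_zero (u := fun θ => Real.sin (2 * angle m θ))
    (Real.contDiff_sin.comp (contDiff_const.mul (angle m).contDiff)) a fun θ => by
      rw [map_add, angle_single, mul_add]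
      have : 2 * (m a * (2 * Real.pi)) = ((2 * m a : ℕ) : ℝ) * (2 * Real.pi) := by push_cast; ring
      rw [this, Real.sin_add_nat_mul_two_pi]
  have hc : ∀ θ, fderiv ℝ (fun θ => Real.sin (2 * angle m θ)) θ (Pi.single a 1)
      = (2 * m a) * Real.cos (2 * angle m θ) := fun θ => by
    rw [(hd θ).fderiv]
    simp [angle_single]
    ring
  simp only [hc, integral_const_mul] at h
  exact (mul_eq_zero.1 h).resolve_left (by simpa using ha)

theorem integral_box_quadratic (m : Fin n → ℕ) {a : Fin n} (ha : m a ≠ 0) (x y : ℝ) :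
    ∫ θ in box n, (x * Real.sin (angle m θ) ^ 2 + y * Real.cos (angle m θ) ^ 2)
      = volume.real (box n) * ((x + y) / 2) := by
  have h : ∀ θ, x * Real.sin (angle m θ) ^ 2 + y * Real.cos (angle m θ) ^ 2
      = (x + y) / 2 + (y - x) / 2 * Real.cos (2 * angle m θ) := fun θ => by
    rw [Real.sin_sq, Real.cos_sq]; ring
  have hint : IntegrableOn (fun θ => (y - x) / 2 * Real.cos (2 * angle m θ)) (box n) :=
    ((by fun_prop : Continuous fun θ => (y - x) / 2 * Real.cos (2 * angle m θ))
      ).continuousOn.integrableOn_compact isCompact_Icc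
  have hconst : IntegrableOn (fun _ => (x + y) / 2) (box n) :=
    integrableOn_const isCompact_Icc.measure_lt_top.ne
  simp only [h]
  rw [integral_add hconst hint, integral_const_mul,
    integral_box_cos_two_mul_angle m ha, mul_zero, add_zero, setIntegral_const, smul_eq_mul]

/-- The second variation of the volume of the product of circles in the direction of the Hamiltonian
field of the trigonometric monomial `cos (∑ m_j θ_j)`. -/
theorem exists_hasSecondVariation (p : ℕ) {r : Fin n → ℝ} (hr : ∀ j, 0 < r j) (m : Fin n → ℕ)
    {a : Fin n} (ha : m a ≠ 0) :
    ∃ X, HasSecondVariation p (circleProduct r) X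
      ((∏ j, r j) * (volume.real (box n) * (((∑ j, sgn p j * m j / r j ^ 2) ^ 2
        - 2 * ∑ j, (m j / r j ^ 2) ^ 2 + (∑ j, sgn p j * m j ^ 2 / r j ^ 2) ^ 2) / 2))) := by
  obtain ⟨X, hX, hnormal, hflow⟩ := exists_hamiltonian_phaseFlow p m hr
  refine ⟨X, hX, hnormal, phaseFlow p m, hflow, ?_⟩
  obtain ⟨δ, hδ, U, -, hLU, hΦ, -, -⟩ := hflow
  have hF := contDiffOn_flow_comp (contDiff_circleProduct r) hLU hΦ
  have hdet : ∀ θ, (inducedMetric p (fun θ => phaseFlow p m 0 (circleProduct r θ)) θ).det ≠ 0 := by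
    simp only [phaseFlow_zero]
    exact det_inducedMetric_circleProduct_ne_zero r p hr
  refine ⟨_, eventually_hasDerivAt_vol p (F := fun t θ => phaseFlow p m t (circleProduct r θ)) hF
    hδ hdet, ?_⟩
  convert hasDerivAt_integral_dt_density p
    (F := fun t θ => phaseFlow p m t (circleProduct r θ)) hF hδ hdet using 1
  simp only [dt_dt_density_phaseFlow p m hr hδ hF, integral_const_mul]
  rw [integral_box_quadratic m ha]

theorem volume_real_box_pos : 0 < volume.real (box n) := by
  rw [measureReal_def, Real.volume_Icc_pi_toReal fun _ => by positivity]
  exact Finset.prod_pos fun _ _ => by simp [Real.pi_pos]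

theorem isHUnstable_circleProduct {p : ℕ} {r : Fin n → ℝ} (hr : ∀ j, 0 < r j) (h0 : p ≠ 0)
    (hp : p < n) : IsHUnstable p (circleProduct r) := by
  -- `a` is the first negative direction, available since `p ≠ 0`; `b` is the first positive one,
  -- available since `p < n`.
  set a : Fin n := ⟨0, by lia⟩ with ha
  set b : Fin n := ⟨p, hp⟩ with hb
  have hab : a ≠ b := by simp [ha, hb, Fin.ext_iff, h0.symm]
  have hsa : sgn p a = -1 := if_pos (by simp [ha]; lia)
  have hsb : sgn p b = 1 := if_neg (by simp [hb])
  have hP : 0 < ∏ j, r j := Finset.prod_pos fun j _ => hr j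
  have hV := volume_real_box_pos (n := n)
  have hra := pow_pos (hr a) 2
  have hrb := pow_pos (hr b) 2
  constructor
  · obtain ⟨X, hX⟩ := exists_hasSecondVariation p hr (Pi.single a 2) (a := a) (by simp)
    refine ⟨X, _, hX, mul_pos hP (mul_pos hV (half_pos ?_))⟩
    have hsum : ∀ g : Fin n → ℕ → ℝ, (∀ j, g j 0 = 0) →
        ∑ j, g j ((Pi.single a 2 : Fin n → ℕ) j) = g a 2 := fun g hg => by
      rw [Finset.sum_eq_single a] <;> simp +contextual [Pi.single_eq_of_ne, hg]
    rw [hsum (fun j k => sgn p j * k / r j ^ 2) (by simp),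
      hsum (fun j k => (k / r j ^ 2) ^ 2) (by simp),
      hsum (fun j k => sgn p j * k ^ 2 / r j ^ 2) (by simp), hsa]
    have : (-1 * ((2 : ℕ) : ℝ) / r a ^ 2) ^ 2 - 2 * (((2 : ℕ) : ℝ) / r a ^ 2) ^ 2
        + (-1 * ((2 : ℕ) : ℝ) ^ 2 / r a ^ 2) ^ 2 = 12 / (r a ^ 2) ^ 2 := by
      push_cast; ring
    rw [this]
    positivity
  -- Mixing opposite signs makes both squares equal to `(1/r_b² - 1/r_a²)²`; subtracting the
  -- diagonal terms leaves only the negative cross term.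
  · obtain ⟨X, hX⟩ := exists_hasSecondVariation p hr (Pi.single a 1 + Pi.single b 1) (a := a)
      (by simp)
    refine ⟨X, _, hX, mul_neg_of_pos_of_neg hP (mul_neg_of_pos_of_neg hV
      (div_neg_of_neg_of_pos ?_ two_pos))⟩
    have hsum : ∀ g : Fin n → ℕ → ℝ, (∀ j, g j 0 = 0) →
        ∑ j, g j ((Pi.single a 1 + Pi.single b 1 : Fin n → ℕ) j) = g a 1 + g b 1 := fun g hg => by
      rw [Finset.sum_eq_add a b hab]
      · simp [hab, hab.symm]
      · rintro c - ⟨hca, hcb⟩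
        simp [hca, hcb, hg]
      · simp
      · simp
    rw [hsum (fun j k => sgn p j * k / r j ^ 2) (by simp),
      hsum (fun j k => (k / r j ^ 2) ^ 2) (by simp),
      hsum (fun j k => sgn p j * k ^ 2 / r j ^ 2) (by simp), hsa, hsb]
    have : (-1 * ((1 : ℕ) : ℝ) / r a ^ 2 + 1 * ((1 : ℕ) : ℝ) / r b ^ 2) ^ 2
        - 2 * ((((1 : ℕ) : ℝ) / r a ^ 2) ^ 2 + (((1 : ℕ) : ℝ) / r b ^ 2) ^ 2)
        + (-1 * ((1 : ℕ) : ℝ) ^ 2 / r a ^ 2 + 1 * ((1 : ℕ) : ℝ) ^ 2 / r b ^ 2) ^ 2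
        = -(4 / (r a ^ 2 * r b ^ 2)) := by
      push_cast; field_simp; ring
    rw [this, neg_lt_zero]
    positivity

end Instability

end PseudoKahler

end


theorem mainTheorem4 (n p : ℕ) (hp : p ≤ n) (r : Fin n → ℝ) (hr : ∀ j, 0 < r j) :
    Set.range (PseudoKahler.circleProduct r)
        = Set.univ.pi (fun j => Metric.sphere (0 : ℂ) (r j)) ∧
    PseudoKahler.IsLagrangian p (PseudoKahler.circleProduct r) ∧
    PseudoKahler.IsHMinimal p (PseudoKahler.circleProduct r) ∧
    (p ≠ 0 → p ≠ n → PseudoKahler.IsHUnstable p (PseudoKahler.circleProduct r)) :=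
  ⟨PseudoKahler.range_circleProduct r hr, PseudoKahler.isLagrangian_circleProduct r p hr,
    PseudoKahler.isHMinimal_circleProduct p hr,
    fun h0 hn => PseudoKahler.isHUnstable_circleProduct hr h0 (lt_of_le_of_ne hp hn)⟩
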